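/- Let $d(n)$ be the number of positive divisors of $n$ and let $K_0(y)=\int_0^\infty e^{-y\cosh v}\,dv$ $(y>0)$ be the Macdonald function. For $\frac12<\delta<1$, $n\ge 1$ and a bounded measurable function $f:\mathbb R\to\mathbb C$ consider the Meijer type convolution transform $$(\mathcal K_n f)(x)=\int_{-\infty}^{\infty} e^{-\delta u}K_0\!\left(2\sqrt n\,e^{(x-u)/2}\right)f(u)\,du,\qquad x\in\mathbb R .$$ The series $$\sum_{n=1}^{\infty} d(n)\left[(\mathcal K_n f)(x)-4(\mathcal K_{2n}f)(x)+4(\mathcal K_{4n}f)(x)\right]$$ is understood with its terms taken in the order of the index of the transform, i.e. as $$\lim_{N\to\infty}\Big[\sum_{n\le N}d(n)(\mathcal K_nf)(x)-4\sum_{2n\le N}d(n)(\mathcal K_{2n}f)(x)+4\sum_{4n\le N}d(n)(\mathcal K_{4n}f)(x)\Big].$$ For all such $\delta$, $f$ and all $x$, the integrals $(\mathcal K_nf)(x)$ are absolutely convergent and this limit exists; it equals $\int_{-\infty}^\infty e^{-\delta u}\,U(e^{x-u})f(u)\,du$ (an absolutely convergent integral), where $U(t)=\sum_{n\ge1}d(n)\left[K_0(2\sqrt{nt})-4K_0(2\sqrt{2nt})+4K_0(4\sqrt{nt})\right]$,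 a series which converges absolutely for every $t>0$. The Riemann hypothesis is true if and only if, for every $\delta\in(\frac12,1)$, the equation $$\sum_{n=1}^{\infty} d(n)\left[(\mathcal K_n f)(x)-4(\mathcal K_{2n}f)(x)+4(\mathcal K_{4n}f)(x)\right]=0\quad\text{for all }x\in\mathbb R$$ has no nontrivial solution: every bounded measurable $f$ on $\mathbb R$ that satisfies it is zero almost everywhere. -/

import Mathlib

open MeasureTheory Filter Topology

noncomputable section

/-- The Macdonald function `K₀(x) = ∫₀^∞ exp (-x cosh v) dv`, for `x > 0`. -/
def macdonaldK0 (x : ℝ) : ℝ :=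
  ∫ v in Set.Ioi (0 : ℝ), Real.exp (-(x * Real.cosh v))

/-- Dirichlet's divisor function: the number of positive divisors of `n`.
At `n = 0` the value is `0`, so that `n = 0` contributes nothing to a sum weighted by it. -/
def divisorCount (n : ℕ) : ℕ := n.divisors.card

/-- The integrand `exp (-δ u) K₀(2 √n exp ((x - u) / 2)) f(u)` of the `n`-th Meijer type
convolution transform. -/
def meijerIntegrand (δ : ℝ) (n : ℕ) (f : ℝ → ℂ) (x u : ℝ) : ℂ :=
  ((Real.exp (-(δ * u)) * macdonaldK0 (2 * √(n : ℝ) * Real.exp ((x - u) / 2)) : ℝ) : ℂ) * f u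

/-- The Meijer type convolution transform
`(𝒦ₙ f)(x) = ∫ exp (-δ u) K₀(2 √n exp ((x - u) / 2)) f(u) du` over the real line. -/
def meijerTransform (δ : ℝ) (n : ℕ) (f : ℝ → ℂ) (x : ℝ) : ℂ :=
  ∫ u : ℝ, meijerIntegrand δ n f x u

/-- The partial sums of `∑ d(n) [(𝒦ₙ f)(x) - 4 (𝒦₂ₙ f)(x) + 4 (𝒦₄ₙ f)(x)]`, the terms
being taken in the order of the index of the transform: the `N`-th partial sum consists of all
the terms `d(n) 𝒦ₙ f`, `-4 d(n) 𝒦₂ₙ f`, `4 d(n) 𝒦₄ₙ f` whose transform has index at most `N`,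
that is, with `n ≤ N`, `2 n ≤ N`, `4 n ≤ N` respectively. -/
def meijerPartialSum (δ : ℝ) (f : ℝ → ℂ) (x : ℝ) (N : ℕ) : ℂ :=
  (∑ n ∈ Finset.Icc 1 N, (divisorCount n : ℂ) * meijerTransform δ n f x)
    - 4 * (∑ n ∈ Finset.Icc 1 (N / 2), (divisorCount n : ℂ) * meijerTransform δ (2 * n) f x)
    + 4 * (∑ n ∈ Finset.Icc 1 (N / 4), (divisorCount n : ℂ) * meijerTransform δ (4 * n) f x)

/-- The term `d(n) [K₀(2 √(n t)) - 4 K₀(2 √(2 n t)) + 4 K₀(4 √(n t))]`. -/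
def divisorKernelTerm (t : ℝ) (n : ℕ) : ℝ :=
  (divisorCount n : ℝ) *
    (macdonaldK0 (2 * √((n : ℝ) * t)) - 4 * macdonaldK0 (2 * √(2 * (n : ℝ) * t))
      + 4 * macdonaldK0 (4 * √((n : ℝ) * t)))

/-- The kernel `∑ d(n) [K₀(2 √(n t)) - 4 K₀(2 √(2 n t)) + 4 K₀(4 √(n t))]`, for `t > 0`. -/
def divisorKernel (t : ℝ) : ℝ := ∑' n : ℕ, divisorKernelTerm t n

/-- Bounded (Lebesgue) measurable functions on the real line. -/
def IsBoundedMeasurable (f : ℝ → ℂ) : Prop :=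
  AEMeasurable f volume ∧ ∃ C : ℝ, ∀ u, ‖f u‖ ≤ C

end

open scoped FourierTransform ContDiff

/-! Since (1 - 2·2^(-s))² = 1 - 4·2^(-s) + 4·4^(-s), the coefficients 1, -4, 4 turn d(n) into the
Dirichlet convolution square of (-1)^(n+1) (`altDivisor_apply`). In a logarithmic variable K₀(2
e^(z/2)) is half the convolution square of exp(-e^w) (`logMacdonald_eq`), and the alternating sum of
e^(-nt) is 1/(1 + e^t). Hence U is half the multiplicative convolution square of the Fermi function
(`divisorKernel_exp`). With φ(w) = e^(δw)/(1 + exp(e^w)), the series therefore equals e^(-δx)/2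
times φ * φ * f.

Convergence comes from cancellation. The hyperbola method bounds the sums of `altDivisor` up to N by
2√N, while the n-th kernel has integral of order n^(-δ). Summation by parts then works for δ > 1/2
(`tendsto_meijerPartialSum`).

The Fourier transform of φ is Γ(s)(1 - 2^(1-s))ζ(s) on the line Re s = δ (`fourier_fermiKernel`).
For 0 < δ < 1 the first two factors have no zeros, so only zeros of ζ matter. Under the Riemann
hypothesis there are none on these lines, and a Wiener theorem, applied twice, gives f = 0. If the
hypothesis fails, a zero with 1/2 < Re s < 1 yields a character annihilated by φ, a nontrivial
solution. The Wiener theorem is elementary here: all moments of φ are finite, so its Fourier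
transform is smooth and test functions can be divided by it. -/

/-! ### Wiener's theorem for bounded functions -/

theorem integral_convolution_mul_swap {φ θ g : ℝ → ℂ} (hφ : Integrable φ) (hθ : Integrable θ)
    (hg : AEStronglyMeasurable g volume) {C : ℝ} (hC : ∀ u, ‖g u‖ ≤ C) :
    ∫ u, (∫ x, θ x * φ (x - u)) * g u = ∫ x, θ x * ∫ u, φ (x - u) * g u := by
  have hint : Integrable (Function.uncurry fun u x : ℝ => θ x * φ (x - u) * g u)
      (volume.prod volume) := by
    have h1 := hθ.convolution_integrand (ContinuousLinearMap.mul ℂ ℂ) hφ.comp_neg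
    have h2 : Integrable (fun p : ℝ × ℝ => θ p.2 * φ (p.2 - p.1)) (volume.prod volume) := by
      refine h1.congr (Eventually.of_forall fun p => ?_)
      simp
    exact h2.mul_bdd (c := C) hg.comp_fst (Eventually.of_forall fun p => hC _)
  simp_rw [← integral_mul_const]
  rw [integral_integral_swap hint]
  simp_rw [mul_assoc, integral_const_mul]

/-- The multiplication formula moves the transform onto the translate of φ. With h = χ/𝓕φ the right
side becomes 𝓕χ. -/
theorem integral_fourier_mul_comp_sub {φ h : ℝ → ℂ} (hφ : Integrable φ) (hh : Integrable h)
    (u : ℝ) : ∫ x, 𝓕 h x * φ (x - u) = 𝓕 (fun ξ => h ξ * 𝓕 φ ξ) u := by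
  have h1 := VectorFourier.integral_fourierIntegral_smul_eq_flip (L := innerₗ ℝ) (μ := volume)
    (ν := volume) (e := Real.fourierChar) (f := h) (g := fun x => φ (x - u))
    Real.continuous_fourierChar continuous_inner hh (hφ.comp_sub_right u)
  have h2 : ∀ ξ, 𝓕 (fun x => φ (x - u)) ξ = Real.fourierChar (-(u * ξ)) • 𝓕 φ ξ := by
    intro ξ
    simp only [Real.fourier_eq]
    rw [← integral_add_right_eq_self _ u, Circle.smul_def, ← integral_smul]
    congr 1; ext v
    rw [← Circle.smul_def, smul_smul, ← AddChar.map_add_eq_mul]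
    simp only [add_sub_cancel_right]
    congr 2
    simp
    ring
  have h3 : ∫ x, 𝓕 h x * φ (x - u) = ∫ ξ, h ξ * 𝓕 (fun x => φ (x - u)) ξ := by
    simpa using! h1
  rw [h3, Real.fourier_eq]
  congr 1; ext ξ
  rw [h2]
  simp only [Circle.smul_def, smul_eq_mul, RCLike.inner_apply, conj_trivial]
  ring

/-- A bounded function whose convolution with `φ` vanishes is annihilated by the Fourier transforms
of all test functions, if the Fourier transform of `φ` is smooth and has no zeros. -/
theorem integral_fourier_mul_eq_zero {φ g : ℝ → ℂ}
    (hφ : ∀ n : ℕ, Integrable fun u => ‖u‖ ^ n * ‖φ u‖) (hφm : AEStronglyMeasurable φ volume)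
    (h0 : ∀ ξ, 𝓕 φ ξ ≠ 0) (hg : AEStronglyMeasurable g volume) {C : ℝ} (hC : ∀ u, ‖g u‖ ≤ C)
    (h : ∀ᵐ x, ∫ u, φ (x - u) * g u = 0) {χ : ℝ → ℂ} (hχ : ContDiff ℝ ∞ χ)
    (hχc : HasCompactSupport χ) : ∫ u, 𝓕 χ u * g u = 0 := by
  have hφi : Integrable φ := by
    rw [← integrable_norm_iff hφm]
    simpa using hφ 0
  have hF : ContDiff ℝ ∞ (𝓕 φ) := Real.contDiff_fourier (N := ⊤) fun n _ => hφ n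
  -- The absence of zeros keeps the quotient a test function, so its Fourier transform is integrable
  -- and may be paired with the convolution.
  have hq : ContDiff ℝ ∞ (fun ξ => χ ξ * (𝓕 φ ξ)⁻¹) := hχ.mul (hF.inv h0)
  have hqc : HasCompactSupport (fun ξ => χ ξ * (𝓕 φ ξ)⁻¹) := hχc.mul_right
  let q := hqc.toSchwartzMap hq
  have hqi : Integrable (fun ξ => χ ξ * (𝓕 φ ξ)⁻¹) := q.integrable
  have hFq : Integrable (𝓕 (fun ξ => χ ξ * (𝓕 φ ξ)⁻¹)) := (𝓕 q).integrable
  have hzero : ∀ᵐ x, 𝓕 (fun ξ => χ ξ * (𝓕 φ ξ)⁻¹) x * ∫ u, φ (x - u) * g u = 0 := by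
    filter_upwards [h] with x hx
    rw [hx, mul_zero]
  have := integral_convolution_mul_swap hφi hFq hg hC
  rw [integral_congr_ae hzero, integral_zero] at this
  simp_rw [integral_fourier_mul_comp_sub hφi hqi] at this
  convert this using 5 with u
  ext ξ
  rw [inv_mul_cancel_right₀ (h0 ξ)]

/-- Modulated and dilated test functions are again test functions; their transforms are the
translates and dilates of 𝓕ρ, which serve as an approximate identity. -/
theorem fourier_scaled_modulated {ρ : ℝ → ℂ} {ε : ℝ} (hε : 0 < ε) (x u : ℝ) :
    𝓕 (fun ξ : ℝ => (Real.fourierChar (x * ξ) : ℂ) * ρ (ε * ξ)) u =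
      (ε⁻¹ : ℂ) * 𝓕 ρ ((u - x) / ε) := by
  simp only [Real.fourier_eq]
  have := Measure.integral_comp_mul_left
    (fun ξ => Real.fourierChar (-inner ℝ ξ ((u - x) / ε)) • ρ ξ) ε
  rw [abs_of_pos (inv_pos.2 hε)] at this
  rw [← Complex.ofReal_inv, ← smul_eq_mul, Complex.coe_smul, ← this]
  congr 1; ext ξ
  simp only [Circle.smul_def, smul_eq_mul, RCLike.inner_apply, conj_trivial, ← mul_assoc,
    ← Circle.coe_mul, ← AddChar.map_add_eq_mul]
  congr 3
  field_simp
  ring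

theorem integral_dilated_eq_zero {g : ℝ → ℂ}
    (h : ∀ χ : ℝ → ℂ, ContDiff ℝ ∞ χ → HasCompactSupport χ → ∫ u, 𝓕 χ u * g u = 0)
    {ρ : ℝ → ℂ} (hρ : ContDiff ℝ ∞ ρ) (hρc : HasCompactSupport ρ) {ε : ℝ} (hε : 0 < ε) (x : ℝ) :
    ∫ v, 𝓕 ρ v * g (x + ε * v) = 0 := by
  have h1 := h (fun ξ : ℝ => (Real.fourierChar (x * ξ) : ℂ) * ρ (ε * ξ)) ?_ ?_
  · simp_rw [fourier_scaled_modulated hε, mul_assoc, integral_const_mul] at h1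
    have h2 := (mul_eq_zero.1 h1).resolve_left (by simpa using hε.ne')
    have h3 := Measure.integral_comp_mul_left (fun v => 𝓕 ρ (v / ε) * g (x + v)) ε
    simp only [mul_div_cancel_left₀ _ hε.ne'] at h3
    rw [h3, ← integral_sub_right_eq_self _ x]
    simp [h2]
  · refine ContDiff.mul ?_ (hρ.comp (by fun_prop))
    simp only [Real.fourierChar_apply]
    refine ContDiff.cexp (ContDiff.mul ?_ contDiff_const)
    have hlin : ContDiff ℝ ∞ fun ξ : ℝ => 2 * Real.pi * (x * ξ) := by fun_prop
    exact Complex.ofRealCLM.contDiff.comp hlin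
  · refine HasCompactSupport.mul_left ?_
    exact hρc.comp_homeomorph (Homeomorph.mulLeft₀ ε hε.ne')

/-- A bounded function annihilated by the Fourier transforms of all test functions vanishes. -/
theorem ae_eq_zero_of_integral_fourier_mul_eq_zero {g : ℝ → ℂ}
    (hg : AEStronglyMeasurable g volume) {C : ℝ} (hC : ∀ u, ‖g u‖ ≤ C)
    (h : ∀ χ : ℝ → ℂ, ContDiff ℝ ∞ χ → HasCompactSupport χ → ∫ u, 𝓕 χ u * g u = 0) :
    g =ᵐ[volume] 0 := by
  have hgl : LocallyIntegrable g volume :=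
    (locallyIntegrable_const C).mono hg (Eventually.of_forall fun u => by
      simpa using (hC u).trans (le_abs_self C))
  refine ae_eq_zero_of_integral_contDiff_smul_eq_zero hgl fun w hw hwc => ?_
  -- The bump equals 1 at the origin, so by Fourier inversion its transform has integral 1.
  obtain ⟨b⟩ : Nonempty (ContDiffBump (0 : ℝ)) := inferInstance
  let ρ : ℝ → ℂ := fun ξ => (b ξ : ℂ)
  have hρ : ContDiff ℝ ∞ ρ := Complex.ofRealCLM.contDiff.comp b.contDiff
  have hρc : HasCompactSupport ρ := b.hasCompactSupport.comp_left Complex.ofReal_zero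
  let S := hρc.toSchwartzMap hρ
  have hP : Integrable (𝓕 ρ) := (𝓕 S).integrable
  have hP1 : ∫ v, 𝓕 ρ v = 1 := by
    have h1 : 𝓕⁻ (𝓕 ρ) = ρ := hρ.continuous.fourierInv_fourier_eq S.integrable hP
    have h2 := congrFun h1 0
    rw [Real.fourierInv_eq] at h2
    simpa [ρ, b.one_of_mem_closedBall (Metric.mem_closedBall_self b.rIn_pos.le)] using h2
  have hwi : Integrable w := hw.continuous.integrable_of_hasCompactSupport hwc
  -- Pairing with w first replaces g by a bounded continuous function, so the approximate identity
  -- can be evaluated at 0 by dominated convergence.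
  let G : ℝ → ℂ := fun t => ∫ x, w x • g (x + t)
  have hGshift : ∀ t, G t = ∫ x, w (x - t) • g x := by
    intro t
    simp only [G]
    rw [← integral_sub_right_eq_self _ t]
    simp
  have hG0 : G 0 = ∫ x, w x • g x := by simp [G]
  have hGc : Continuous G := by
    have h1 := HasCompactSupport.continuous_convolution_right (ContinuousLinearMap.lsmul ℝ ℝ).flip
      (μ := volume) (f := g) (g := fun x => w (-x)) ?_ hgl (hw.continuous.comp continuous_neg)
    · convert h1 using 1
      ext t
      rw [hGshift]
      simp [convolution]
    · exact hwc.comp_homeomorph (Homeomorph.neg ℝ)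
  have hGb : ∀ t, ‖G t‖ ≤ ∫ x, ‖w x‖ * C := by
    intro t
    refine norm_integral_le_of_norm_le (hwi.norm.mul_const C) (Eventually.of_forall fun x => ?_)
    rw [norm_smul]
    gcongr
    exact hC _
  have hzero : ∀ ε : ℝ, 0 < ε → ∫ v, 𝓕 ρ v * G (ε * v) = 0 := by
    intro ε hε
    have hint : Integrable (Function.uncurry fun v x : ℝ => 𝓕 ρ v * (w x • g (x + ε * v)))
        (volume.prod volume) := by
      have h1 : Integrable (fun p : ℝ × ℝ => 𝓕 ρ p.1 * (w p.2 : ℂ)) (volume.prod volume) :=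
        hP.mul_prod hwi.ofReal
      have h2 : Integrable (fun p : ℝ × ℝ => 𝓕 ρ p.1 * (w p.2 : ℂ) * g (p.2 + ε * p.1))
          (volume.prod volume) := by
        refine h1.mul_bdd (c := C) ?_ (Eventually.of_forall fun p => hC _)
        refine hg.comp_quasiMeasurePreserving ?_
        refine QuasiMeasurePreserving.prod_of_right (by fun_prop) (Eventually.of_forall fun v => ?_)
        exact (measurePreserving_add_right volume (ε * v)).quasiMeasurePreserving
      refine h2.congr (Eventually.of_forall fun p => ?_)
      simp [Function.uncurry, mul_assoc]
    have h3 : ∀ v, 𝓕 ρ v * G (ε * v) = ∫ x, 𝓕 ρ v * (w x • g (x + ε * v)) := fun v => by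
      rw [integral_const_mul]
    simp_rw [h3]
    rw [integral_integral_swap hint]
    have h4 : ∀ x, ∫ v, 𝓕 ρ v * (w x • g (x + ε * v)) = 0 := by
      intro x
      simp_rw [mul_smul_comm, integral_smul, integral_dilated_eq_zero h hρ hρc hε, smul_zero]
    rw [integral_congr_ae (Eventually.of_forall h4), integral_zero]
  have hlim : Tendsto (fun n : ℕ => ∫ v, 𝓕 ρ v * G (1 / ((n : ℝ) + 1) * v)) atTop
      (𝓝 (∫ v, 𝓕 ρ v * G 0)) := by
    refine tendsto_integral_of_dominated_convergence
      (fun v => ‖𝓕 ρ v‖ * ∫ x, ‖w x‖ * C) (fun n => ?_) (hP.norm.mul_const _)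
      (fun n => Eventually.of_forall fun v => ?_) (Eventually.of_forall fun v => ?_)
    · exact hP.aestronglyMeasurable.mul (hGc.comp (by fun_prop)).aestronglyMeasurable
    · rw [norm_mul]
      gcongr
      exact hGb _
    · refine Tendsto.const_mul _ ((hGc.tendsto 0).comp ?_)
      simpa using (tendsto_one_div_add_atTop_nhds_zero_nat (𝕜 := ℝ)).mul_const v
  have h5 : ∀ n : ℕ, ∫ v, 𝓕 ρ v * G (1 / ((n : ℝ) + 1) * v) = 0 := fun n => hzero _ (by positivity)
  simp_rw [h5, integral_mul_const, hP1, one_mul, hG0] at hlim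
  exact (tendsto_nhds_unique hlim tendsto_const_nhds)

/-- Wiener's theorem for a kernel all of whose moments are finite: if its Fourier transform has no
zeros, then the convolution with it is injective on bounded functions. -/
theorem ae_eq_zero_of_convolution_eq_zero {φ g : ℝ → ℂ}
    (hφ : ∀ n : ℕ, Integrable fun u => ‖u‖ ^ n * ‖φ u‖) (hφm : AEStronglyMeasurable φ volume)
    (h0 : ∀ ξ, 𝓕 φ ξ ≠ 0) (hg : AEStronglyMeasurable g volume) {C : ℝ} (hC : ∀ u, ‖g u‖ ≤ C)
    (h : ∀ᵐ x, ∫ u, φ (x - u) * g u = 0) : g =ᵐ[volume] 0 :=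
  ae_eq_zero_of_integral_fourier_mul_eq_zero hg hC fun _ hχ hχc =>
    integral_fourier_mul_eq_zero hφ hφm h0 hg hC h hχ hχc

/-! ### The alternating divisor function and its summatory function -/

/-- The alternating sign `(-1)^(n+1)`, with value `0` at `n = 0`. -/
noncomputable def altSign : ArithmeticFunction ℝ :=
  ⟨fun n => if n = 0 then 0 else (-1) ^ (n + 1), by simp⟩

/-- The indicator function of the positive integer `a`. -/
noncomputable def indicatorAt (a : ℕ) : ArithmeticFunction ℝ :=
  ⟨fun n => if n = 0 then 0 else if n = a then 1 else 0, by simp⟩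

/-- The Dirichlet convolution square of the alternating sign. -/
noncomputable def altDivisor : ArithmeticFunction ℝ := altSign * altSign

theorem altSign_apply {n : ℕ} (hn : n ≠ 0) : altSign n = (-1) ^ (n + 1) := by
  simp [altSign, hn]

theorem abs_altSign_le (n : ℕ) : |altSign n| ≤ 1 := by
  by_cases hn : n = 0
  · simp [hn]
  · simp [altSign_apply hn]

theorem indicatorAt_mul_apply {a : ℕ} (ha : a ≠ 0) (f : ArithmeticFunction ℝ) (n : ℕ) :
    (indicatorAt a * f) n = if a ∣ n then f (n / a) else 0 := by
  rcases eq_or_ne n 0 with rfl | hn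
  · simp
  rw [ArithmeticFunction.mul_apply]
  have h1 : ∀ p ∈ n.divisorsAntidiagonal,
      indicatorAt a p.1 * f p.2 = if p.1 = a then f (n / a) else 0 := by
    intro p hp
    obtain ⟨hp1, -⟩ := Nat.mem_divisorsAntidiagonal.1 hp
    have hp0 : p.1 ≠ 0 := by rintro h; simp [h] at hp1; omega
    by_cases h : p.1 = a
    · have : n / a = p.2 := by
        rw [← hp1, ← h, Nat.mul_div_cancel_left _ (Nat.pos_of_ne_zero hp0)]
      simp [indicatorAt, h, ha, this]
    · simp [indicatorAt, h]
  rw [Finset.sum_congr rfl h1]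
  split_ifs with hd
  · obtain ⟨b, rfl⟩ := hd
    rw [Finset.sum_eq_single (a, b)]
    · simp
    · intro p hp hne
      rw [if_neg]
      intro h
      apply hne
      obtain ⟨hp1, -⟩ := Nat.mem_divisorsAntidiagonal.1 hp
      rw [h] at hp1
      exact Prod.ext h (Nat.eq_of_mul_eq_mul_left (Nat.pos_of_ne_zero ha) hp1)
    · intro h
      exact absurd (Nat.mem_divisorsAntidiagonal.2 ⟨rfl, hn⟩) h
  · refine Finset.sum_eq_zero fun p hp => if_neg ?_
    rintro rfl
    exact hd (Dvd.intro _ (Nat.mem_divisorsAntidiagonal.1 hp).1)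

theorem indicatorAt_two_mul_self : indicatorAt 2 * indicatorAt 2 = indicatorAt 4 := by
  ext n
  rw [indicatorAt_mul_apply two_ne_zero]
  simp only [indicatorAt, ArithmeticFunction.coe_mk]
  split_ifs <;> first | rfl | omega

/-- The indicator of the even numbers is `indicatorAt 2 * zeta`; subtracting it twice from 1 flips
the sign there. -/
theorem altSign_eq :
    altSign = (1 - 2 * indicatorAt 2) * (ArithmeticFunction.zeta : ArithmeticFunction ℝ) := by
  ext n
  rcases eq_or_ne n 0 with rfl | hn
  · simp
  have h2 : (2 * indicatorAt 2 * (ArithmeticFunction.zeta : ArithmeticFunction ℝ)) n =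
      2 * (indicatorAt 2 * (ArithmeticFunction.zeta : ArithmeticFunction ℝ)) n := by
    rw [two_mul, add_mul, ArithmeticFunction.add_apply, ← two_mul]
  rw [sub_mul, one_mul, sub_eq_add_neg, ArithmeticFunction.add_apply, ArithmeticFunction.neg_apply,
    h2, indicatorAt_mul_apply two_ne_zero, altSign_apply hn]
  rcases Nat.even_or_odd n with h | h
  · have hd : n / 2 ≠ 0 := by obtain ⟨k, rfl⟩ := h; omega
    rw [if_pos h.two_dvd, h.add_one.neg_one_pow]
    simp [hn, hd]
    norm_num
  · rw [if_neg h.not_two_dvd_nat, h.add_one.neg_one_pow]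
    simp [hn]

/-- Dirichlet's divisor function as a real arithmetic function. -/
noncomputable def divisorFun : ArithmeticFunction ℝ :=
  (ArithmeticFunction.zeta : ArithmeticFunction ℝ) * (ArithmeticFunction.zeta :)

theorem divisorFun_apply (n : ℕ) : divisorFun n = divisorCount n := by
  rw [divisorFun, ArithmeticFunction.coe_zeta_mul_apply, divisorCount]
  have h : ∀ i ∈ n.divisors, (ArithmeticFunction.zeta : ArithmeticFunction ℝ) i = 1 := fun i hi => by
    simp [(Nat.pos_of_mem_divisors hi).ne']
  rw [Finset.sum_congr rfl h]
  simp

theorem altDivisor_apply (n : ℕ) : altDivisor n =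
    divisorFun n - 4 * (if 2 ∣ n then divisorFun (n / 2) else 0)
      + 4 * (if 4 ∣ n then divisorFun (n / 4) else 0) := by
  rw [← indicatorAt_mul_apply two_ne_zero, ← indicatorAt_mul_apply four_ne_zero]
  -- The factors 4 are spelled out as sums, and the negative term is moved across, so that
  -- evaluation at n needs only additivity.
  have h : altDivisor + (indicatorAt 2 * divisorFun + indicatorAt 2 * divisorFun +
      (indicatorAt 2 * divisorFun + indicatorAt 2 * divisorFun)) = divisorFun +
      (indicatorAt 4 * divisorFun + indicatorAt 4 * divisorFun +
      (indicatorAt 4 * divisorFun + indicatorAt 4 * divisorFun)) := by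
    rw [altDivisor, altSign_eq, ← indicatorAt_two_mul_self, divisorFun]
    ring
  have := congrArg (fun f : ArithmeticFunction ℝ => f n) h
  simp only [ArithmeticFunction.add_apply] at this
  linarith

theorem sum_ite_dvd {R : Type*} [AddCommMonoid R] {a : ℕ} (ha : 0 < a) (N : ℕ) (F : ℕ → R) :
    ∑ n ∈ Finset.Ioc 0 N, (if a ∣ n then F n else 0) = ∑ n ∈ Finset.Icc 1 (N / a), F (a * n) := by
  rw [← Finset.sum_filter]
  symm
  refine Finset.sum_bij (fun n _ => a * n) (fun n hn => ?_) (fun m _ n _ h => ?_) (fun n hn => ?_)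
    (fun n _ => rfl)
  · simp only [Finset.mem_Icc, Finset.mem_filter, Finset.mem_Ioc] at hn ⊢
    exact ⟨⟨Nat.mul_pos ha hn.1, mul_comm n a ▸ (Nat.le_div_iff_mul_le ha).1 hn.2⟩, dvd_mul_right _ _⟩
  · exact Nat.eq_of_mul_eq_mul_left ha h
  · simp only [Finset.mem_filter, Finset.mem_Ioc] at hn
    obtain ⟨⟨h1, h2⟩, b, rfl⟩ := hn
    exact ⟨b, Finset.mem_Icc.2 ⟨Nat.pos_of_mul_pos_left h1, (Nat.le_div_iff_mul_le ha).2 (mul_comm a b ▸ h2)⟩, rfl⟩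

/-- Sums weighted by `altDivisor`, regrouped into three sums weighted by the divisor function. -/
theorem sum_altDivisor_mul (g : ℕ → ℂ) (N : ℕ) :
    ∑ n ∈ Finset.Ioc 0 N, (altDivisor n : ℂ) * g n =
      (∑ n ∈ Finset.Icc 1 N, (divisorCount n : ℂ) * g n)
        - 4 * (∑ n ∈ Finset.Icc 1 (N / 2), (divisorCount n : ℂ) * g (2 * n))
        + 4 * (∑ n ∈ Finset.Icc 1 (N / 4), (divisorCount n : ℂ) * g (4 * n)) := by
  have h : ∀ n, (altDivisor n : ℂ) * g n = (divisorCount n : ℂ) * g n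
      - 4 * (if 2 ∣ n then (divisorCount (n / 2) : ℂ) * g n else 0)
      + 4 * (if 4 ∣ n then (divisorCount (n / 4) : ℂ) * g n else 0) := by
    intro n
    rw [altDivisor_apply]
    simp only [divisorFun_apply]
    split_ifs <;> push_cast <;> ring
  simp_rw [h, Finset.sum_add_distrib, Finset.sum_sub_distrib, ← Finset.mul_sum]
  rw [sum_ite_dvd two_pos, sum_ite_dvd four_pos]
  have h2 : ∀ n, 2 * n / 2 = n := fun n => by omega
  have h4 : ∀ n, 4 * n / 4 = n := fun n => by omega
  simp_rw [h2, h4]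
  rfl

theorem abs_sum_altSign_le (a b : ℕ) : |∑ n ∈ Finset.Ioc a b, altSign n| ≤ 1 := by
  -- Consecutive signs cancel in pairs; an odd block leaves its first term, (-1)^(a+2).
  have key : ∀ k, ∑ n ∈ Finset.Ioc a (a + k), altSign n =
      if Even k then 0 else (-1) ^ a := by
    intro k
    induction k with
    | zero => simp
    | succ k ih =>
      rw [← add_assoc, Finset.sum_Ioc_succ_top (by omega), ih, altSign_apply (by omega)]
      rcases Nat.even_or_odd k with hk | hk
      · rw [if_pos hk, if_neg (by simpa [Nat.even_add_one] using hk)]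
        rw [show a + k + 1 + 1 = a + (k + 2) by ring, pow_add, (hk.add even_two).neg_one_pow]
        simp
      · rw [if_neg (by simpa using hk), if_pos (by simpa [Nat.even_add_one] using hk)]
        rw [show a + k + 1 + 1 = a + (k + 2) by ring, pow_add,
          (hk.add_even even_two).neg_one_pow]
        simp
  rcases le_total a b with h | h
  · obtain ⟨k, rfl⟩ := Nat.exists_eq_add_of_le h
    rw [key]
    split_ifs <;> simp
  · simp [Finset.Ioc_eq_empty_of_le h]

/-- Dirichlet's hyperbola method for the alternating divisor sum. -/
theorem abs_sum_altDivisor_le (N : ℕ) : |∑ n ∈ Finset.Ioc 0 N, altDivisor n| ≤ 2 * √(N : ℝ) := by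
  rw [altDivisor, ArithmeticFunction.sum_Ioc_mul_eq_sum_sum]
  set r := Nat.sqrt N with hr
  have hrN : r ≤ N := Nat.sqrt_le_self N
  have hr1 : r * r ≤ N := Nat.sqrt_le N
  have hr2 : N < (r + 1) * (r + 1) := Nat.lt_succ_sqrt N
  rw [← Finset.sum_Ioc_consecutive _ (Nat.zero_le r) hrN]
  simp_rw [Finset.mul_sum]
  -- If nm ≤ N and n > r then m ≤ r. In both regions the outer variable thus takes at most r values,
  -- and each inner alternating sum is at most 1 in absolute value.
  have hcomm : ∑ n ∈ Finset.Ioc r N, ∑ m ∈ Finset.Ioc 0 (N / n), altSign n * altSign m =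
      ∑ m ∈ Finset.Ioc 0 r, ∑ n ∈ Finset.Ioc r (N / m), altSign n * altSign m := by
    refine Finset.sum_comm' fun n m => ?_
    simp only [Finset.mem_Ioc]
    constructor
    · rintro ⟨⟨h1, h2⟩, h3, h4⟩
      rw [Nat.le_div_iff_mul_le (by omega)] at h4
      refine ⟨⟨h1, (Nat.le_div_iff_mul_le h3).2 (by linarith)⟩, h3, ?_⟩
      by_contra hcon
      push Not at hcon
      nlinarith
    · rintro ⟨⟨h1, h2⟩, h3, h4⟩
      rw [Nat.le_div_iff_mul_le h3] at h2
      refine ⟨⟨h1, by nlinarith⟩, h3, (Nat.le_div_iff_mul_le (by omega)).2 (by linarith)⟩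
  have hb : ∀ x y : ℝ, |x| ≤ 1 → |y| ≤ 1 → |x * y| ≤ 1 := fun x y hx hy => by
    rw [abs_mul]; exact mul_le_one₀ hx (abs_nonneg _) hy
  have hA : |∑ n ∈ Finset.Ioc 0 r, ∑ m ∈ Finset.Ioc 0 (N / n), altSign n * altSign m| ≤ r := by
    refine (Finset.abs_sum_le_sum_abs _ _).trans ?_
    refine (Finset.sum_le_card_nsmul _ _ 1 fun n _ => ?_).trans (by simp)
    rw [← Finset.mul_sum]
    exact hb _ _ (abs_altSign_le n) (abs_sum_altSign_le _ _)
  have hB : |∑ m ∈ Finset.Ioc 0 r, ∑ n ∈ Finset.Ioc r (N / m), altSign n * altSign m| ≤ r := by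
    refine (Finset.abs_sum_le_sum_abs _ _).trans ?_
    refine (Finset.sum_le_card_nsmul _ _ 1 fun n _ => ?_).trans (by simp)
    rw [← Finset.sum_mul]
    exact hb _ _ (abs_sum_altSign_le _ _) (abs_altSign_le n)
  have hrs : (r : ℝ) ≤ √(N : ℝ) := Real.nat_sqrt_le_real_sqrt
  rw [hcomm]
  exact (abs_add_le _ _).trans (by linarith)

/-- Abel summation. The term n = 0 carries an empty sum, so the value of g at 0 is irrelevant. -/
theorem sum_Ioc_mul_by_parts (c g : ℕ → ℂ) (N : ℕ) :
    ∑ n ∈ Finset.Ioc 0 N, c n * g n = (∑ n ∈ Finset.Ioc 0 N, c n) * g (N + 1) +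
      ∑ n ∈ Finset.range (N + 1), (∑ k ∈ Finset.Ioc 0 n, c k) * (g n - g (n + 1)) := by
  induction N with
  | zero => simp
  | succ N ih =>
    rw [Finset.sum_Ioc_succ_top (Nat.zero_le N), ih, Finset.sum_range_succ _ (N + 1),
      Finset.sum_Ioc_succ_top (Nat.zero_le N)]
    ring

/-! ### Exponential and Fermi kernels; the Macdonald function as a convolution -/

theorem HasSum.of_eq {ι R : Type*} [AddCommMonoid R] [TopologicalSpace R] {f g : ι → R} {a : R}
    (hf : HasSum f a) (h : ∀ i, f i = g i) : HasSum g a :=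
  funext h ▸ hf

theorem hasSum_altSign_mul_exp {t : ℝ} (ht : 0 < t) :
    HasSum (fun n : ℕ => altSign n * Real.exp (-(n * t))) (1 / (1 + Real.exp t)) := by
  have hq : ‖-Real.exp (-t)‖ < 1 := by
    rw [norm_neg, Real.norm_of_nonneg (Real.exp_pos _).le]
    simpa using ht
  have h := (hasSum_geometric_of_norm_lt_one hq).mul_left (Real.exp (-t))
  have hterm : ∀ n : ℕ, altSign (n + 1) * Real.exp (-((n + 1 : ℕ) * t)) =
      Real.exp (-t) * (-Real.exp (-t)) ^ n := by
    intro n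
    rw [altSign_apply (Nat.succ_ne_zero n)]
    have : -(((n + 1 : ℕ) : ℝ) * t) = -t + n * (-t) := by push_cast; ring
    rw [this, Real.exp_add, Real.exp_nat_mul, neg_pow (Real.exp (-t)), pow_succ, pow_succ]
    ring
  have hval : 1 / (1 + Real.exp t) -
      ∑ i ∈ Finset.range 1, altSign i * Real.exp (-(i * t)) =
        Real.exp (-t) * (1 - -Real.exp (-t))⁻¹ := by
    have := Real.exp_pos t
    simp only [Finset.range_one, Finset.sum_singleton, ArithmeticFunction.map_zero, zero_mul,
      sub_zero, sub_neg_eq_add, Real.exp_neg]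
    field_simp
    ring
  rw [← hasSum_nat_add_iff' 1, hval]
  exact h.of_eq fun n => (hterm n).symm

/-- The function `exp (a w) exp (-exp w)`, whose integral is `Γ(a)`. -/
noncomputable def gammaKernel (a w : ℝ) : ℝ := Real.exp (a * w) * Real.exp (-Real.exp w)

/-- The function `exp (a w) / (1 + exp (exp w))`. -/
noncomputable def fermiKernel (a w : ℝ) : ℝ := Real.exp (a * w) * (1 / (1 + Real.exp (Real.exp w)))

theorem continuous_gammaKernel (a : ℝ) : Continuous (gammaKernel a) := by
  unfold gammaKernel; fun_prop

theorem continuous_fermiKernel (a : ℝ) : Continuous (fermiKernel a) := by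
  unfold fermiKernel
  exact (by fun_prop : Continuous fun w : ℝ => Real.exp (a * w)).mul
    (continuous_const.div (by fun_prop) fun w => by positivity)

theorem gammaKernel_nonneg (a w : ℝ) : 0 ≤ gammaKernel a w := by unfold gammaKernel; positivity

theorem fermiKernel_nonneg (a w : ℝ) : 0 ≤ fermiKernel a w := by unfold fermiKernel; positivity

theorem fermiKernel_le (a w : ℝ) : fermiKernel a w ≤ gammaKernel a w := by
  unfold fermiKernel gammaKernel
  gcongr
  rw [Real.exp_neg, one_div]
  gcongr
  linarith

theorem gammaKernel_add (a b w : ℝ) : gammaKernel (a + b) w = Real.exp (b * w) * gammaKernel a w := by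
  simp only [gammaKernel]
  rw [add_mul, Real.exp_add]
  ring

theorem fermiKernel_add (a b w : ℝ) : fermiKernel (a + b) w = Real.exp (b * w) * fermiKernel a w := by
  simp only [fermiKernel]
  rw [add_mul, Real.exp_add]
  ring

/-- The substitution t = e^w in Euler's integral for Γ(a). -/
theorem integrable_gammaKernel {a : ℝ} (ha : 0 < a) : Integrable (gammaKernel a) := by
  have h1 := Real.GammaIntegral_convergent ha
  have him : Real.exp '' Set.univ = Set.Ioi 0 := by rw [Set.image_univ, Real.range_exp]
  rw [← him, integrableOn_image_iff_integrableOn_abs_deriv_smul MeasurableSet.univ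
    (fun x _ => (Real.hasDerivAt_exp x).hasDerivWithinAt) Real.exp_injective.injOn,
    integrableOn_univ] at h1
  refine h1.congr (Eventually.of_forall fun w => ?_)
  simp only [gammaKernel, smul_eq_mul, abs_of_pos (Real.exp_pos w)]
  rw [← Real.exp_mul, mul_left_comm, ← Real.exp_add, mul_comm]
  ring_nf

theorem integrable_fermiKernel {a : ℝ} (ha : 0 < a) : Integrable (fermiKernel a) :=
  (integrable_gammaKernel ha).mono' (continuous_fermiKernel a).aestronglyMeasurable
    (Eventually.of_forall fun w => by
      rw [Real.norm_of_nonneg (fermiKernel_nonneg a w)]; exact fermiKernel_le a w)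

/-- Only the cubic term of the exponential series is used. The exponent 3 later gives decay n^(-3),
enough to absorb d(n) ≤ n. -/
theorem gammaKernel_three_le (w : ℝ) : gammaKernel 3 w ≤ 6 := by
  have h := Real.pow_div_factorial_le_exp (Real.exp w) (Real.exp_pos w).le 3
  have h2 : Real.exp (3 * w) = Real.exp w ^ 3 := by
    rw [← Real.exp_nat_mul]; norm_num
  rw [gammaKernel, h2, Real.exp_neg, ← div_eq_mul_inv, div_le_iff₀ (Real.exp_pos _)]
  have : ((3 : ℕ).factorial : ℝ) = 6 := by norm_num [Nat.factorial]
  rw [this, div_le_iff₀ (by norm_num)] at h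
  linarith

/-- The weights e^(bw) and e^(b(z-w)) multiply to e^(bz), independent of w. This supplies the decay
at -∞ that the unweighted factors lack. -/
theorem gammaKernel_zero_mul (b z w : ℝ) : gammaKernel 0 w * gammaKernel 0 (z - w) =
    Real.exp (-(b * z)) * (gammaKernel b w * gammaKernel b (z - w)) := by
  have h1 := gammaKernel_add 0 b w
  have h2 := gammaKernel_add 0 b (z - w)
  rw [zero_add] at h1 h2
  have : Real.exp (-(b * z)) * (Real.exp (b * w) * Real.exp (b * (z - w))) = 1 := by
    rw [← Real.exp_add, ← Real.exp_add, ← Real.exp_zero]; ring_nf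
  rw [h1, h2]
  linear_combination -(gammaKernel 0 w * gammaKernel 0 (z - w)) * this

theorem fermiKernel_zero_mul (b z w : ℝ) : fermiKernel 0 w * fermiKernel 0 (z - w) =
    Real.exp (-(b * z)) * (fermiKernel b w * fermiKernel b (z - w)) := by
  have h1 := fermiKernel_add 0 b w
  have h2 := fermiKernel_add 0 b (z - w)
  rw [zero_add] at h1 h2
  have : Real.exp (-(b * z)) * (Real.exp (b * w) * Real.exp (b * (z - w))) = 1 := by
    rw [← Real.exp_add, ← Real.exp_add, ← Real.exp_zero]; ring_nf
  rw [h1, h2]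
  linear_combination -(fermiKernel 0 w * fermiKernel 0 (z - w)) * this

theorem integrable_gammaKernel_mul (z : ℝ) :
    Integrable fun w => gammaKernel 0 w * gammaKernel 0 (z - w) := by
  simp_rw [gammaKernel_zero_mul 3 z]
  refine Integrable.const_mul ?_ _
  refine (integrable_gammaKernel three_pos).mul_bdd (c := 6)
    ((continuous_gammaKernel 3).comp (by fun_prop)).aestronglyMeasurable
    (Eventually.of_forall fun w => ?_)
  rw [Real.norm_of_nonneg (gammaKernel_nonneg _ _)]
  exact gammaKernel_three_le _

/-- The Macdonald function `K₀(2 exp (z / 2))` in a logarithmic variable. -/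
noncomputable def logMacdonald (z : ℝ) : ℝ := macdonaldK0 (2 * Real.exp (z / 2))

/-- Put w = v + z/2: then e^w + e^(z-w) = 2 e^(z/2) cosh v, and evenness in v accounts for the
factor 1/2. -/
theorem logMacdonald_eq (z : ℝ) :
    logMacdonald z = 1 / 2 * ∫ w, gammaKernel 0 w * gammaKernel 0 (z - w) := by
  have h1 := integral_comp_abs
    (f := fun v => Real.exp (-(2 * Real.exp (z / 2) * Real.cosh v)))
  simp only [Real.cosh_abs] at h1
  have h2 : macdonaldK0 (2 * Real.exp (z / 2)) =
      ∫ v in Set.Ioi (0 : ℝ), Real.exp (-(2 * Real.exp (z / 2) * Real.cosh v)) := rfl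
  have h3 : ∀ v, gammaKernel 0 (v + z / 2) * gammaKernel 0 (z - (v + z / 2)) =
      Real.exp (-(2 * Real.exp (z / 2) * Real.cosh v)) := by
    intro v
    simp only [gammaKernel, zero_mul, Real.exp_zero, one_mul]
    rw [← Real.exp_add, Real.cosh_eq]
    congr 1
    rw [show v + z / 2 = z / 2 + v by ring, show z - (z / 2 + v) = z / 2 + -v by ring,
      Real.exp_add, Real.exp_add]
    ring
  rw [logMacdonald, h2,
    ← integral_add_right_eq_self (fun w => gammaKernel 0 w * gammaKernel 0 (z - w)) (z / 2)]
  simp_rw [h3, h1]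
  ring

theorem integral_gammaKernel_shift (z a b : ℝ) :
    ∫ w, gammaKernel 0 (w + a) * gammaKernel 0 (z - w + b) = 2 * logMacdonald (z + a + b) := by
  rw [logMacdonald_eq, ← integral_add_right_eq_self
    (fun w => gammaKernel 0 w * gammaKernel 0 (z + a + b - w)) a]
  rw [← mul_assoc, mul_one_div_cancel two_ne_zero, one_mul]
  congr 1; ext w
  congr 2
  ring

theorem integrable_gammaKernel_shift (z a b : ℝ) :
    Integrable fun w => gammaKernel 0 (w + a) * gammaKernel 0 (z - w + b) := by
  refine ((integrable_gammaKernel_mul (z + a + b)).comp_add_right a).congr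
    (Eventually.of_forall fun w => ?_)
  simp only
  congr 2
  ring

theorem logMacdonald_nonneg (z : ℝ) : 0 ≤ logMacdonald z := by
  rw [logMacdonald_eq]
  exact mul_nonneg (by norm_num)
    (integral_nonneg fun w => mul_nonneg (gammaKernel_nonneg _ _) (gammaKernel_nonneg _ _))

theorem antitone_logMacdonald : Antitone logMacdonald := by
  intro z z' h
  simp only [logMacdonald_eq]
  refine mul_le_mul_of_nonneg_left (integral_mono (integrable_gammaKernel_mul _)
    (integrable_gammaKernel_mul _) fun w => ?_) (by norm_num)
  refine mul_le_mul_of_nonneg_left ?_ (gammaKernel_nonneg _ _)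
  simp only [gammaKernel, zero_mul, Real.exp_zero, one_mul]
  gcongr

theorem exists_logMacdonald_le : ∃ B : ℝ, 0 ≤ B ∧ ∀ z, logMacdonald z ≤ B * Real.exp (-(3 * z)) := by
  have h0 : ∀ w, 0 ≤ gammaKernel 3 w * 6 := fun w =>
    mul_nonneg (gammaKernel_nonneg _ _) (by norm_num)
  refine ⟨1 / 2 * ∫ w, gammaKernel 3 w * 6, mul_nonneg one_half_pos.le (integral_nonneg h0),
    fun z => ?_⟩
  rw [logMacdonald_eq, mul_assoc, mul_comm _ (Real.exp _), ← integral_const_mul (Real.exp (-(3 * z)))]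
  refine mul_le_mul_of_nonneg_left (integral_mono (integrable_gammaKernel_mul _)
    (((integrable_gammaKernel three_pos).mul_const 6).const_mul _) fun w => ?_) one_half_pos.le
  simp only
  rw [gammaKernel_zero_mul 3 z]
  have := gammaKernel_three_le (z - w)
  have := gammaKernel_nonneg 3 w
  gcongr

theorem exp_mul_logMacdonald (δ z : ℝ) : Real.exp (δ * z) * logMacdonald z =
    1 / 2 * ∫ w, gammaKernel δ w * gammaKernel δ (z - w) := by
  rw [logMacdonald_eq]
  simp_rw [gammaKernel_zero_mul δ z, integral_const_mul]
  rw [mul_left_comm, ← mul_assoc (Real.exp _), ← Real.exp_add]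
  simp

theorem integrable_exp_mul_logMacdonald {δ : ℝ} (hδ : 0 < δ) :
    Integrable fun z => Real.exp (δ * z) * logMacdonald z := by
  simp_rw [exp_mul_logMacdonald]
  exact ((integrable_gammaKernel hδ).integrable_convolution (ContinuousLinearMap.mul ℝ ℝ)
    (integrable_gammaKernel hδ)).const_mul _

theorem exp_log_mul (k : ℕ) (hk : k ≠ 0) : Real.exp (-(3 * Real.log k)) = ((k : ℝ) ^ 3)⁻¹ := by
  have : (0 : ℝ) < k := by positivity
  rw [Real.exp_neg, ← Real.exp_log (pow_pos this 3), Real.log_pow]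
  norm_num

theorem hasSum_fermiKernel (w : ℝ) :
    HasSum (fun n : ℕ => altSign n * gammaKernel 0 (w + Real.log n)) (fermiKernel 0 w) := by
  have hE : ∀ n : ℕ, altSign n * gammaKernel 0 (w + Real.log n) =
      altSign n * Real.exp (-(n * Real.exp w)) := by
    intro n
    rcases eq_or_ne n 0 with rfl | hn
    · simp
    · simp only [gammaKernel, zero_mul, Real.exp_zero, one_mul]
      rw [Real.exp_add, Real.exp_log (by positivity), mul_comm (Real.exp w)]
  refine HasSum.of_eq ?_ fun n => (hE n).symm
  simpa [fermiKernel] using hasSum_altSign_mul_exp (Real.exp_pos w)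

theorem hasSum_fermiKernel_mul (z w : ℝ) :
    HasSum (fun p : ℕ × ℕ => altSign p.1 * altSign p.2 *
      (gammaKernel 0 (w + Real.log p.1) * gammaKernel 0 (z - w + Real.log p.2)))
      (fermiKernel 0 w * fermiKernel 0 (z - w)) := by
  have h1 := hasSum_fermiKernel w
  have h2 := hasSum_fermiKernel (z - w)
  have hs : Summable fun p : ℕ × ℕ => altSign p.1 * gammaKernel 0 (w + Real.log p.1) *
      (altSign p.2 * gammaKernel 0 (z - w + Real.log p.2)) :=
    summable_mul_of_summable_norm (f := fun n : ℕ => altSign n * gammaKernel 0 (w + Real.log n))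
      (g := fun n : ℕ => altSign n * gammaKernel 0 (z - w + Real.log n))
      h1.summable.norm h2.summable.norm
  refine (h1.mul h2 hs).of_eq fun p => ?_
  ring

/-- The product of two Fermi series is integrated term by term; the (p, q) term has L¹ norm
O((pq)^(-3)). -/
theorem hasSum_altSign_pairs (z : ℝ) :
    HasSum (fun p : ℕ × ℕ => altSign p.1 * altSign p.2 *
        logMacdonald (z + Real.log p.1 + Real.log p.2))
      (1 / 2 * ∫ w, fermiKernel 0 w * fermiKernel 0 (z - w)) := by
  obtain ⟨B, hB0, hB⟩ := exists_logMacdonald_le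
  let F : ℕ × ℕ → ℝ → ℝ := fun p w => altSign p.1 * altSign p.2 *
    (gammaKernel 0 (w + Real.log p.1) * gammaKernel 0 (z - w + Real.log p.2))
  have hFi : ∀ p, Integrable (F p) := fun p => (integrable_gammaKernel_shift _ _ _).const_mul _
  have hs : Summable fun n : ℕ => ((n : ℝ) ^ 3)⁻¹ := Real.summable_nat_pow_inv.2 (by norm_num)
  have hpair : Summable fun p : ℕ × ℕ => ((p.1 : ℝ) ^ 3)⁻¹ * ((p.2 : ℝ) ^ 3)⁻¹ :=
    hs.mul_of_nonneg hs (fun n => by positivity) (fun n => by positivity)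
  have hFs : Summable fun p => ∫ w, ‖F p w‖ := by
    refine Summable.of_nonneg_of_le (fun p => integral_nonneg fun w => norm_nonneg _) (fun p => ?_)
      (hpair.mul_left (2 * B * Real.exp (-(3 * z))))
    have h1 : ∀ w, ‖F p w‖ = |altSign p.1| * |altSign p.2| *
        (gammaKernel 0 (w + Real.log p.1) * gammaKernel 0 (z - w + Real.log p.2)) := fun w => by
      simp only [F, Real.norm_eq_abs, abs_mul]
      rw [abs_of_nonneg (gammaKernel_nonneg _ _), abs_of_nonneg (gammaKernel_nonneg _ _)]
    simp_rw [h1, integral_const_mul, integral_gammaKernel_shift]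
    by_cases hp1 : p.1 = 0
    · simp [hp1]
    by_cases hp2 : p.2 = 0
    · simp [hp2]
    have h2 := hB (z + Real.log p.1 + Real.log p.2)
    rw [mul_add, mul_add, neg_add, neg_add, Real.exp_add, Real.exp_add, exp_log_mul _ hp1,
      exp_log_mul _ hp2] at h2
    calc _ ≤ 1 * 1 * (2 * logMacdonald (z + Real.log p.1 + Real.log p.2)) := by
          have := logMacdonald_nonneg (z + Real.log p.1 + Real.log p.2)
          have h3 := abs_altSign_le p.1
          have h4 := abs_altSign_le p.2
          gcongr
      _ ≤ _ := by linarith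
  have hsum := hasSum_integral_of_summable_integral_norm hFi hFs
  have ht : ∀ w, ∑' p, F p w = fermiKernel 0 w * fermiKernel 0 (z - w) :=
    fun w => (hasSum_fermiKernel_mul z w).tsum_eq
  simp_rw [ht] at hsum
  refine (hsum.mul_left (1 / 2)).of_eq fun p => ?_
  simp only [F]
  rw [integral_const_mul, integral_gammaKernel_shift]
  ring

theorem hasSum_altDivisor (z : ℝ) :
    HasSum (fun n : ℕ => altDivisor n * logMacdonald (z + Real.log n))
      (1 / 2 * ∫ w, fermiKernel 0 w * fermiKernel 0 (z - w)) := by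
  have h := (hasSum_altSign_pairs z).tsum_fiberwise (fun p : ℕ × ℕ => p.1 * p.2)
  refine h.of_eq fun n => ?_
  rw [eq_comm]
  rcases eq_or_ne n 0 with rfl | hn
  · rw [ArithmeticFunction.map_zero, zero_mul, eq_comm]
    -- The fibre over 0 is infinite, but each of its pairs has a zero entry, where the sign
    -- vanishes.
    convert tsum_zero with p
    obtain ⟨⟨a, b⟩, hp⟩ := p
    rcases Nat.mul_eq_zero.1 (show a * b = 0 from hp) with rfl | rfl <;> simp
  · rw [show (fun p : ℕ × ℕ ↦ p.1 * p.2) ⁻¹' {n} = n.divisorsAntidiagonal by ext; simp [hn],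
      Finset.tsum_subtype' n.divisorsAntidiagonal fun p => altSign p.1 * altSign p.2 *
        logMacdonald (z + Real.log p.1 + Real.log p.2), altDivisor, ArithmeticFunction.mul_apply,
      Finset.sum_mul]
    refine Finset.sum_congr rfl fun p hp => ?_
    obtain ⟨hp1, -⟩ := Nat.mem_divisorsAntidiagonal.1 hp
    have h1 : (p.1 : ℝ) ≠ 0 := fun h => hn (by rw [← hp1, Nat.cast_eq_zero.1 h, zero_mul])
    have h2 : (p.2 : ℝ) ≠ 0 := fun h => hn (by rw [← hp1, Nat.cast_eq_zero.1 h, mul_zero])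
    rw [← hp1, Nat.cast_mul, Real.log_mul h1 h2, add_assoc]

/-! ### Mellin and Fourier transforms of the Fermi function -/

/-- The Dirichlet series of the alternating sign is `(1 - 2^(1-s)) ζ(s)`. -/
theorem hasSum_altSign_div_cpow {s : ℂ} (hs : 1 < s.re) :
    HasSum (fun n : ℕ => (altSign n : ℂ) / (n : ℂ) ^ s) ((1 - 2 ^ (1 - s)) * riemannZeta s) := by
  have hs0 : s ≠ 0 := by rintro rfl; norm_num at hs
  have h1 : HasSum (fun n : ℕ => 1 / (n : ℂ) ^ s) (riemannZeta s) := by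
    rw [zeta_eq_tsum_one_div_nat_cpow hs]
    exact (Complex.summable_one_div_nat_cpow.2 hs).hasSum
  have h2 : HasSum (fun n : ℕ => if Even n then 1 / (n : ℂ) ^ s else 0)
      ((2 : ℂ) ^ (-s) * riemannZeta s) := by
    have hinj : Function.Injective (fun n : ℕ => 2 * n) := fun a b h => by
      simpa using h
    rw [← hinj.hasSum_iff]
    · refine (h1.mul_left ((2 : ℂ) ^ (-s))).of_eq fun n => ?_
      have := Complex.natCast_mul_natCast_cpow 2 n s
      simp only [Function.comp, even_two, Even.mul_right, if_true]
      rw [Nat.cast_mul, this, Complex.cpow_neg]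
      simp [mul_comm]
    · intro n hn
      refine if_neg fun h => hn ?_
      obtain ⟨k, rfl⟩ := h
      exact ⟨k, by ring⟩
  have h3 := h1.sub (h2.mul_left 2)
  have hval : riemannZeta s - 2 * ((2 : ℂ) ^ (-s) * riemannZeta s) =
      (1 - 2 ^ (1 - s)) * riemannZeta s := by
    rw [sub_eq_add_neg 1 s, Complex.cpow_add _ _ two_ne_zero, Complex.cpow_one]
    ring
  rw [← hval]
  refine h3.of_eq fun n => ?_
  rcases eq_or_ne n 0 with rfl | hn
  · simp [hs0]
  rw [altSign_apply hn]
  split_ifs with h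
  · rw [h.add_one.neg_one_pow]; push_cast; ring
  · rw [(Nat.not_even_iff_odd.1 h).add_one.neg_one_pow]; simp

/-- The Fermi function `1 / (1 + exp t)`, with complex values. -/
noncomputable def fermiFun (t : ℝ) : ℂ := ((1 / (1 + Real.exp t) : ℝ) : ℂ)

theorem continuous_fermiFun : Continuous fermiFun :=
  Complex.continuous_ofReal.comp (continuous_const.div (by fun_prop) fun t => by positivity)

theorem mellin_fermiFun_of_one_lt_re {s : ℂ} (hs : 1 < s.re) :
    mellin fermiFun s = Complex.Gamma s * ((1 - 2 ^ (1 - s)) * riemannZeta s) := by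
  have h := hasSum_mellin (a := fun n : ℕ => (altSign n : ℂ)) (p := fun n : ℕ => (n : ℝ))
    (F := fermiFun) (s := s) (fun n => ?_) (by linarith) (fun t ht => ?_) ?_
  · refine h.unique (((hasSum_altSign_div_cpow hs).mul_left (Complex.Gamma s)).of_eq fun n => ?_)
    simp [mul_div_assoc]
  · rcases Nat.eq_zero_or_pos n with rfl | hn
    · simp
    · exact Or.inr (by exact_mod_cast hn)
  · refine (Complex.hasSum_ofReal.2 (hasSum_altSign_mul_exp ht)).of_eq fun n => ?_
    push_cast
    rw [neg_mul]
  · refine Summable.of_nonneg_of_le (fun n => by positivity) (fun n => ?_)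
      (Real.summable_one_div_nat_rpow.2 hs)
    rw [Complex.norm_real, Real.norm_eq_abs]
    have := abs_altSign_le n
    gcongr

theorem differentiableAt_mellin_fermiFun {s : ℂ} (hs : 0 < s.re) :
    DifferentiableAt ℂ (mellin fermiFun) s := by
  have hb : ∀ t, ‖fermiFun t‖ = 1 / (1 + Real.exp t) := fun t => by
    rw [fermiFun, Complex.norm_real, Real.norm_of_nonneg (by positivity)]
  refine mellin_differentiableAt_of_isBigO_rpow_exp (a := 1) (b := 0) one_pos
    (continuous_fermiFun.locallyIntegrable.locallyIntegrableOn _) ?_ ?_ hs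
  · refine Asymptotics.IsBigO.of_bound 1 (Eventually.of_forall fun t => ?_)
    rw [hb, Real.norm_of_nonneg (Real.exp_pos _).le, one_mul, neg_mul, one_mul, Real.exp_neg,
      one_div]
    gcongr
    linarith
  · refine Asymptotics.IsBigO.of_bound 1 (Eventually.of_forall fun t => ?_)
    rw [hb, neg_zero, Real.rpow_zero, norm_one, mul_one, div_le_one (by positivity)]
    linarith [Real.exp_pos t]

/-- Analytic continuation from Re s > 1. Multiplying by s - 1 removes the pole of ζ, so both sides
are analytic on the whole half plane Re s > 0. -/
theorem mellin_fermiFun {s : ℂ} (hs : 0 < s.re) (hs1 : s ≠ 1) :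
    mellin fermiFun s = Complex.Gamma s * ((1 - 2 ^ (1 - s)) * riemannZeta s) := by
  let U : Set ℂ := {s | 0 < s.re}
  have hUo : IsOpen U := isOpen_lt continuous_const Complex.continuous_re
  have hUc : IsPreconnected U := (convex_halfSpace_re_gt 0).isPreconnected
  have hf : AnalyticOnNhd ℂ (fun s => (s - 1) * mellin fermiFun s) U := by
    refine DifferentiableOn.analyticOnNhd (fun s hs => ?_) hUo
    exact ((differentiableAt_id.sub_const 1).mul
      (differentiableAt_mellin_fermiFun hs)).differentiableWithinAt
  have hg : AnalyticOnNhd ℂ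
      (fun s => Complex.Gamma s * ((1 - 2 ^ (1 - s)) * riemannZeta₁ s)) U := by
    refine DifferentiableOn.analyticOnNhd (fun s hs => ?_) hUo
    have h1 : DifferentiableAt ℂ Complex.Gamma s := by
      refine Complex.differentiableAt_Gamma s fun m h => ?_
      have hre : s.re = -m := by rw [h]; simp
      have : (0 : ℝ) < s.re := hs
      have : (0 : ℝ) ≤ m := m.cast_nonneg
      linarith
    have h2 : DifferentiableAt ℂ (fun s : ℂ => 1 - (2 : ℂ) ^ (1 - s)) s :=
      (DifferentiableAt.const_cpow (by fun_prop) (Or.inl two_ne_zero)).const_sub 1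
    exact (h1.mul (h2.mul (differentiable_riemannZeta₁ s))).differentiableWithinAt
  have heq : ∀ s : ℂ, 1 < s.re → (s - 1) * mellin fermiFun s =
      Complex.Gamma s * ((1 - 2 ^ (1 - s)) * riemannZeta₁ s) := by
    intro s hs
    have hne : s - 1 ≠ 0 := sub_ne_zero.2 (by rintro rfl; norm_num at hs)
    rw [mellin_fermiFun_of_one_lt_re hs, riemannZeta_eq_inv_sub_mul (sub_ne_zero.1 hne)]
    field_simp
  have hev : (fun s => (s - 1) * mellin fermiFun s) =ᶠ[𝓝 2]
      (fun s => Complex.Gamma s * ((1 - 2 ^ (1 - s)) * riemannZeta₁ s)) := by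
    filter_upwards [(isOpen_lt continuous_const Complex.continuous_re).mem_nhds
      (show (1 : ℝ) < (2 : ℂ).re by norm_num)] with s hs using heq s hs
  have h := hf.eqOn_of_preconnected_of_eventuallyEq hg hUc (show (0 : ℝ) < (2 : ℂ).re by norm_num)
    hev hs
  have hne : s - 1 ≠ 0 := sub_ne_zero.2 hs1
  simp only at h
  rw [riemannZeta_eq_inv_sub_mul hs1]
  apply mul_left_cancel₀ hne
  rw [h]
  field_simp

theorem fourier_fermiKernel {δ : ℝ} (hδ : 0 < δ) (hδ1 : δ ≠ 1) (ξ : ℝ) :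
    𝓕 (fun w => (fermiKernel δ w : ℂ)) ξ =
      Complex.Gamma ⟨δ, -(2 * Real.pi * ξ)⟩ *
        ((1 - 2 ^ (1 - (⟨δ, -(2 * Real.pi * ξ)⟩ : ℂ))) *
          riemannZeta ⟨δ, -(2 * Real.pi * ξ)⟩) := by
  rw [← mellin_fermiFun (by exact hδ) (fun h => hδ1 (congrArg Complex.re h)), mellin_eq_fourier,
    Real.fourier_eq, Real.fourier_eq, ← integral_neg_eq_self]
  congr 1; ext w
  have h1 : -(2 * Real.pi * ξ) / (2 * Real.pi) = -ξ := by
    field_simp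
  rw [h1, inner_neg_left, inner_neg_right]
  congr 1
  simp [fermiKernel, fermiFun]

/-- Γ has no zeros, and |2^(1-s)| = 2^(1-δ) > 1 keeps the middle factor away from 0. -/
theorem fourier_fermiKernel_ne_zero {δ : ℝ} (hδ : 0 < δ) (hδ1 : δ < 1)
    (hζ : ∀ s : ℂ, s.re = δ → riemannZeta s ≠ 0) (ξ : ℝ) :
    𝓕 (fun w => (fermiKernel δ w : ℂ)) ξ ≠ 0 := by
  rw [fourier_fermiKernel hδ hδ1.ne]
  refine mul_ne_zero (Complex.Gamma_ne_zero_of_re_pos (by exact hδ))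
    (mul_ne_zero (fun h => ?_) (hζ _ rfl))
  have h1 := congrArg norm (sub_eq_zero.1 h)
  rw [norm_one, show (2 : ℂ) = ((2 : ℝ) : ℂ) by simp, Complex.norm_cpow_eq_rpow_re_of_pos two_pos] at h1
  simp only [Complex.sub_re, Complex.one_re] at h1
  have := Real.one_lt_rpow (one_lt_two (α := ℝ)) (sub_pos.2 hδ1)
  linarith

/-- The power |w|^n is dominated by a multiple of e^(δ|w|/2), which only shifts the exponent δ to
3δ/2 or δ/2, both still positive. -/
theorem integrable_pow_mul_fermiKernel {δ : ℝ} (hδ : 0 < δ) (n : ℕ) :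
    Integrable fun w => ‖w‖ ^ n * ‖(fermiKernel δ w : ℂ)‖ := by
  have h1 := ((integrable_fermiKernel (a := δ + δ / 2) (by positivity)).add
    (integrable_fermiKernel (a := δ + -(δ / 2)) (by linarith))).const_mul
      (n.factorial * (2 / δ) ^ n)
  refine h1.mono' ?_ (Eventually.of_forall fun w => ?_)
  · exact ((continuous_norm.pow n).mul (Complex.continuous_ofReal.comp
      (continuous_fermiKernel δ)).norm).aestronglyMeasurable
  · have h2 := Real.pow_div_factorial_le_exp (δ / 2 * |w|) (by positivity) n
    have h3 : Real.exp (δ / 2 * |w|) ≤ Real.exp (δ / 2 * w) + Real.exp (-(δ / 2) * w) := by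
      rcases abs_cases w with ⟨h, -⟩ | ⟨h, -⟩ <;> rw [h]
      · linarith [Real.exp_pos (-(δ / 2) * w)]
      · rw [mul_neg, ← neg_mul]
        linarith [Real.exp_pos (δ / 2 * w)]
    have h4 : |w| ^ n ≤ n.factorial * (2 / δ) ^ n *
        (Real.exp (δ / 2 * w) + Real.exp (-(δ / 2) * w)) := by
      calc |w| ^ n = n.factorial * (2 / δ) ^ n * ((δ / 2 * |w|) ^ n / n.factorial) := by
            have : (n.factorial : ℝ) ≠ 0 := by positivity
            rw [mul_pow, div_pow, div_pow]
            field_simp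
        _ ≤ _ := by gcongr; exact h2.trans h3
    have h0 := fermiKernel_nonneg δ w
    simp only [norm_mul, norm_pow, norm_norm, Complex.norm_real, Pi.add_apply]
    rw [Real.norm_of_nonneg h0, Real.norm_eq_abs, fermiKernel_add, fermiKernel_add, ← add_mul,
      ← mul_assoc]
    gcongr

/-! ### Zeros of ζ to the right of the critical line -/

/-- If the Riemann hypothesis fails, there is a zero of `ζ` in the right half of the strip. -/
theorem exists_zero_of_not_riemannHypothesis (h : ¬ RiemannHypothesis) :
    ∃ s : ℂ, 1 / 2 < s.re ∧ s.re < 1 ∧ riemannZeta s = 0 := by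
  unfold RiemannHypothesis at h
  push Not at h
  obtain ⟨s, hs0, hs, hs1, hre⟩ := h
  have hlt : ∀ w : ℂ, riemannZeta w = 0 → w.re < 1 := fun w hw => by
    by_contra hcon
    exact riemannZeta_ne_zero_of_one_le_re (not_lt.1 hcon) hw
  rcases lt_or_gt_of_ne hre with hre | hre
  · have hw : 1 / 2 < (1 - s).re := by simp; linarith
    have hsne : s ≠ 0 := by
      rintro rfl
      rw [riemannZeta_zero] at hs0
      norm_num at hs0
    have hfe := riemannZeta_one_sub (s := 1 - s) (fun n hn => ?_) (fun hn => hsne ?_)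
    · rw [sub_sub_cancel, hs0, eq_comm] at hfe
      have hG : Complex.Gamma (1 - s) ≠ 0 := Complex.Gamma_ne_zero_of_re_pos (by linarith)
      have hpi : (2 * (Real.pi : ℂ)) ^ (-(1 - s)) ≠ 0 := by
        rw [Ne, Complex.cpow_eq_zero_iff]
        simp [Real.pi_ne_zero]
      rcases mul_eq_zero.1 hfe with hfe | hfe
      · have hcos := (mul_eq_zero.1 hfe).resolve_left
          (mul_ne_zero (mul_ne_zero two_ne_zero hpi) hG)
        obtain ⟨k, hk⟩ := Complex.cos_eq_zero_iff.1 hcos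
        have hpi0 : (Real.pi : ℂ) ≠ 0 := by exact_mod_cast Real.pi_ne_zero
        -- A zero of the cosine forces s = -2k, with k ≥ 0 because Re s < 1/2. Then s is 0, where ζ
        -- = -1/2, or a trivial zero.
        have hsk : s = ((-2 * k : ℤ) : ℂ) := by
          have h2 : (Real.pi : ℂ) * (1 - s) = Real.pi * (2 * k + 1) := by linear_combination 2 * hk
          have := mul_left_cancel₀ hpi0 h2
          push_cast
          linear_combination -this
        have hk0 : (0 : ℝ) ≤ k := by
          have : s.re = ((-2 * k : ℤ) : ℝ) := by rw [hsk, Complex.intCast_re]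
          push_cast at this
          have h3 : (-1 : ℝ) < k := by linarith
          exact_mod_cast Int.lt_iff_add_one_le.1 (by exact_mod_cast h3 : (-1 : ℤ) < k)
        obtain ⟨m, rfl⟩ := Int.eq_ofNat_of_zero_le (by exact_mod_cast hk0 : (0 : ℤ) ≤ k)
        rcases m with _ | m
        · exact absurd (by simpa using hsk) hsne
        · exact absurd (by rw [hsk]; push_cast; ring) (hs m)
      · exact ⟨1 - s, hw, hlt _ hfe, hfe⟩
    · have := congrArg Complex.re hn
      have h0 : (0 : ℝ) ≤ n := n.cast_nonneg
      simp only [Complex.neg_re, Complex.natCast_re] at this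
      linarith
    · linear_combination -hn
  · exact ⟨s, hre, hlt s hs0, hs0⟩

/-! ### The summed kernel U -/

theorem macdonaldK0_mul_sqrt {a : ℕ} (ha : a ≠ 0) (z : ℝ) :
    macdonaldK0 (2 * √(a * Real.exp z)) = logMacdonald (z + Real.log a) := by
  have : (0 : ℝ) < a := by positivity
  rw [logMacdonald, Real.exp_half, Real.exp_add, Real.exp_log this, mul_comm (Real.exp z)]

theorem divisorKernelTerm_exp (z : ℝ) (n : ℕ) : divisorKernelTerm (Real.exp z) n =
    divisorCount n * logMacdonald (z + Real.log n)
      - 4 * (divisorCount n * logMacdonald (z + Real.log (2 * n : ℕ)))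
      + 4 * (divisorCount n * logMacdonald (z + Real.log (4 * n : ℕ))) := by
  rcases eq_or_ne n 0 with rfl | hn
  · simp [divisorKernelTerm, divisorCount]
  rw [divisorKernelTerm, ← macdonaldK0_mul_sqrt hn, ← macdonaldK0_mul_sqrt (by omega),
    ← macdonaldK0_mul_sqrt (by omega)]
  have : √(((4 * n : ℕ) : ℝ) * Real.exp z) = 2 * √(n * Real.exp z) := by
    rw [show ((4 * n : ℕ) : ℝ) * Real.exp z = 2 ^ 2 * (n * Real.exp z) by push_cast; ring,
      Real.sqrt_mul (by positivity), Real.sqrt_sq two_pos.le]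
  rw [this, ← mul_assoc 2 2]
  push_cast
  norm_num
  ring

theorem exists_logMacdonald_add_log_le (z : ℝ) : ∃ B : ℝ, 0 ≤ B ∧
    ∀ n : ℕ, n ≠ 0 → logMacdonald (z + Real.log n) ≤ B * ((n : ℝ) ^ 3)⁻¹ := by
  obtain ⟨B, hB0, hB⟩ := exists_logMacdonald_le
  refine ⟨B * Real.exp (-(3 * z)), by positivity, fun n hn => ?_⟩
  have := hB (z + Real.log n)
  rwa [mul_add, neg_add, Real.exp_add, exp_log_mul n hn, ← mul_assoc] at this

theorem summable_divisorCount_mul (z : ℝ) {a : ℕ} (ha : 0 < a) :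
    Summable fun n : ℕ => divisorCount n * logMacdonald (z + Real.log (a * n : ℕ)) := by
  obtain ⟨B, hB0, hB⟩ := exists_logMacdonald_add_log_le z
  refine Summable.of_nonneg_of_le (fun n => mul_nonneg (Nat.cast_nonneg _) (logMacdonald_nonneg _))
    (fun n => ?_) ((Real.summable_nat_pow_inv.2 (le_refl 2)).mul_left B)
  rcases eq_or_ne n 0 with rfl | hn
  · simp [divisorCount]
  have h1 : (divisorCount n : ℝ) ≤ n := by exact_mod_cast Nat.card_divisors_le_self n
  have hn0 : (0 : ℝ) < n := by positivity
  have h2 : logMacdonald (z + Real.log (a * n : ℕ)) ≤ B * ((n : ℝ) ^ 3)⁻¹ := by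
    refine le_trans (antitone_logMacdonald ?_) (hB n hn)
    gcongr
    exact Nat.le_mul_of_pos_left n ha
  calc _ ≤ (n : ℝ) * (B * ((n : ℝ) ^ 3)⁻¹) :=
        mul_le_mul h1 h2 (logMacdonald_nonneg _) hn0.le
    _ = _ := by field_simp

theorem summable_divisorKernelTerm {t : ℝ} (ht : 0 < t) : Summable (divisorKernelTerm t) := by
  rw [← Real.exp_log ht, funext (divisorKernelTerm_exp _)]
  have h1 := summable_divisorCount_mul (Real.log t) one_pos
  simp only [one_mul] at h1
  exact (h1.sub ((summable_divisorCount_mul _ two_pos).mul_left 4)).add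
    ((summable_divisorCount_mul _ four_pos).mul_left 4)

theorem tendsto_sum_Icc_one {f : ℕ → ℂ} {a : ℂ} (h0 : f 0 = 0) (h : HasSum f a) :
    Tendsto (fun N : ℕ => ∑ n ∈ Finset.Icc 1 N, f n) atTop (𝓝 a) := by
  have h1 := h.tendsto_sum_nat.comp (tendsto_add_atTop_nat 1)
  refine h1.congr fun N => ?_
  simp only [Function.comp]
  rw [Finset.range_eq_Ico, Finset.sum_eq_sum_Ico_succ_bot (Nat.succ_pos N), h0, zero_add]
  rfl

/-- The kernel of the series is half of the multiplicative convolution square of the Fermi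
function. -/
theorem divisorKernel_exp (z : ℝ) :
    divisorKernel (Real.exp z) = 1 / 2 * ∫ w, fermiKernel 0 w * fermiKernel 0 (z - w) := by
  let g : ℕ → ℂ := fun n => (logMacdonald (z + Real.log n) : ℂ)
  have hs : ∀ a : ℕ, 0 < a → HasSum (fun n : ℕ => (divisorCount n : ℂ) * g (a * n))
      ((∑' n : ℕ, divisorCount n * logMacdonald (z + Real.log (a * n : ℕ)) : ℝ) : ℂ) := fun a ha => by
    refine (Complex.hasSum_ofReal.2 (summable_divisorCount_mul z ha).hasSum).of_eq fun n => ?_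
    simp [g]
  have h0 : ∀ a : ℕ, (divisorCount 0 : ℂ) * g (a * 0) = 0 := fun a => by simp [divisorCount]
  have hdiv : ∀ a : ℕ, 0 < a → Tendsto (fun N : ℕ => N / a) atTop atTop := fun a ha =>
    Nat.tendsto_div_const_atTop ha.ne'
  have h1 := tendsto_sum_Icc_one (h0 1) (hs 1 one_pos)
  have h2 := (tendsto_sum_Icc_one (h0 2) (hs 2 two_pos)).comp (hdiv 2 two_pos)
  have h4 := (tendsto_sum_Icc_one (h0 4) (hs 4 four_pos)).comp (hdiv 4 four_pos)
  -- Each of the three series converges on its own, so the cut-offs N, N/2, N/4 do not affect the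
  -- limit.
  have hl := (h1.sub (h2.const_mul 4)).add (h4.const_mul 4)
  have hr := tendsto_sum_Icc_one (by simp) (Complex.hasSum_ofReal.2 (hasSum_altDivisor z))
  have heq : ∀ N : ℕ, ∑ n ∈ Finset.Icc 1 N,
      ((altDivisor n * logMacdonald (z + Real.log n) : ℝ) : ℂ) =
        ∑ n ∈ Finset.Icc 1 N, (divisorCount n : ℂ) * g (1 * n)
          - 4 * ∑ n ∈ Finset.Icc 1 (N / 2), (divisorCount n : ℂ) * g (2 * n)
          + 4 * ∑ n ∈ Finset.Icc 1 (N / 4), (divisorCount n : ℂ) * g (4 * n) := by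
    intro N
    simp only [one_mul]
    rw [← sum_altDivisor_mul]
    exact Finset.sum_congr rfl fun n _ => by simp [g]
  have hlim := tendsto_nhds_unique hl (hr.congr heq)
  have hlim' : (∑' n : ℕ, divisorCount n * logMacdonald (z + Real.log (1 * n : ℕ)))
      - 4 * (∑' n : ℕ, divisorCount n * logMacdonald (z + Real.log (2 * n : ℕ)))
      + 4 * (∑' n : ℕ, divisorCount n * logMacdonald (z + Real.log (4 * n : ℕ))) =
      1 / 2 * ∫ w, fermiKernel 0 w * fermiKernel 0 (z - w) := by
    exact_mod_cast hlim
  rw [← hlim', divisorKernel]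
  refine HasSum.tsum_eq ?_
  refine ((((summable_divisorCount_mul z one_pos).hasSum).sub
    ((summable_divisorCount_mul z two_pos).hasSum.mul_left 4)).add
    ((summable_divisorCount_mul z four_pos).hasSum.mul_left 4)).of_eq fun n => ?_
  rw [divisorKernelTerm_exp, one_mul]

/-- The summatory function of `altDivisor`. -/
noncomputable def altDivisorSum (N : ℕ) : ℂ := ∑ n ∈ Finset.Ioc 0 N, (altDivisor n : ℂ)

theorem norm_altDivisorSum_le (N : ℕ) : ‖altDivisorSum N‖ ≤ 2 * √(N : ℝ) := by
  rw [altDivisorSum, ← Complex.ofReal_sum, Complex.norm_real]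
  exact abs_sum_altDivisor_le N

theorem logMacdonald_add_log_succ_le (z : ℝ) (n : ℕ) :
    logMacdonald (z + Real.log (n + 1 : ℕ)) ≤ logMacdonald (z + Real.log n) := by
  refine antitone_logMacdonald ?_
  rcases eq_or_ne n 0 with rfl | hn
  · simp
  have : (0 : ℝ) < n := by positivity
  gcongr
  omega

/-- Summation by parts in the series for the kernel. -/
theorem hasSum_altDivisorSum_mul (z : ℝ) :
    HasSum (fun n : ℕ => altDivisorSum n *
      ((logMacdonald (z + Real.log n) : ℂ) - logMacdonald (z + Real.log (n + 1 : ℕ))))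
      (divisorKernel (Real.exp z)) := by
  obtain ⟨B, hB0, hB⟩ := exists_logMacdonald_add_log_le z
  have hs2 : Summable fun n : ℕ => 2 * B * ((n : ℝ) ^ 2)⁻¹ :=
    (Real.summable_nat_pow_inv.2 (le_refl 2)).mul_left (2 * B)
  -- The bound 2√n ≤ 2n against n^(-3) leaves n^(-2); it serves both the summed terms and the
  -- boundary term.
  have hbound : ∀ (n : ℕ) (y : ℝ), 0 ≤ y → y ≤ logMacdonald (z + Real.log n) →
      ‖altDivisorSum n * (y : ℂ)‖ ≤ 2 * B * ((n : ℝ) ^ 2)⁻¹ := by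
    intro n y hy0 hy
    rcases eq_or_ne n 0 with rfl | hn
    · simp [altDivisorSum]
    have hn0 : (0 : ℝ) < n := by positivity
    have hn1 : (1 : ℝ) ≤ n := by exact_mod_cast Nat.one_le_iff_ne_zero.2 hn
    have hsq : √(n : ℝ) ≤ n := Real.sqrt_le_iff.2 ⟨hn0.le, by nlinarith⟩
    rw [norm_mul, Complex.norm_real, Real.norm_of_nonneg hy0]
    calc _ ≤ (2 * (n : ℝ)) * (B * ((n : ℝ) ^ 3)⁻¹) :=
          mul_le_mul ((norm_altDivisorSum_le n).trans (by linarith)) (hy.trans (hB n hn)) hy0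
            (by positivity)
      _ = _ := by field_simp
  have hsum : Summable fun n : ℕ => altDivisorSum n *
      ((logMacdonald (z + Real.log n) : ℂ) - logMacdonald (z + Real.log (n + 1 : ℕ))) := by
    refine Summable.of_norm_bounded hs2 fun n => ?_
    rw [← Complex.ofReal_sub]
    refine hbound n _ (sub_nonneg.2 (logMacdonald_add_log_succ_le z n)) ?_
    linarith [logMacdonald_nonneg (z + Real.log (n + 1 : ℕ))]
  have h0 : Tendsto (fun n : ℕ => altDivisorSum n * (logMacdonald (z + Real.log (n + 1 : ℕ)) : ℂ))
      atTop (𝓝 0) :=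
    squeeze_zero_norm (fun n => hbound n _ (logMacdonald_nonneg _)
      (logMacdonald_add_log_succ_le z n)) hs2.tendsto_atTop_zero
  have h1 := hsum.hasSum.tendsto_sum_nat.comp (tendsto_add_atTop_nat 1)
  have h2 := tendsto_sum_Icc_one (by simp) (Complex.hasSum_ofReal.2 (hasSum_altDivisor z))
  have h3 := (h0.add h1).congr fun N => (sum_Ioc_mul_by_parts (fun n => (altDivisor n : ℂ))
    (fun n => (logMacdonald (z + Real.log n) : ℂ)) N).symm
  have h4 := tendsto_nhds_unique h3 (h2.congr fun N => by
    simp only [Complex.ofReal_mul]; rfl)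
  rw [zero_add] at h4
  rw [divisorKernel_exp, ← h4]
  exact hsum.hasSum

/-! ### Meijer transforms and convergence of the series -/

/-- The kernel `exp (-δ u) K₀(2 √n exp ((x - u) / 2))` in a logarithmic form. -/
noncomputable def meijerKernel (δ x : ℝ) (n : ℕ) (u : ℝ) : ℝ :=
  Real.exp (-(δ * u)) * logMacdonald (x - u + Real.log n)

theorem meijerIntegrand_eq (δ : ℝ) {n : ℕ} (hn : n ≠ 0) (f : ℝ → ℂ) (x u : ℝ) :
    meijerIntegrand δ n f x u = (meijerKernel δ x n u : ℂ) * f u := by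
  rw [meijerIntegrand, meijerKernel, ← macdonaldK0_mul_sqrt hn, Real.sqrt_mul (Nat.cast_nonneg n),
    ← Real.exp_half, mul_assoc]

theorem meijerKernel_nonneg (δ x : ℝ) (n : ℕ) (u : ℝ) : 0 ≤ meijerKernel δ x n u :=
  mul_nonneg (Real.exp_pos _).le (logMacdonald_nonneg _)

theorem meijerKernel_eq (δ x : ℝ) (n : ℕ) (u : ℝ) : meijerKernel δ x n u =
    Real.exp (-(δ * (x + Real.log n))) *
      (Real.exp (δ * (x + Real.log n - u)) * logMacdonald (x + Real.log n - u)) := by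
  rw [← mul_assoc, ← Real.exp_add, meijerKernel]
  ring_nf

theorem integrable_meijerKernel {δ : ℝ} (hδ : 0 < δ) (x : ℝ) (n : ℕ) :
    Integrable (meijerKernel δ x n) := by
  rw [funext (meijerKernel_eq δ x n)]
  exact ((integrable_exp_mul_logMacdonald hδ).comp_sub_left (x + Real.log n)).const_mul _

/-- By `meijerKernel_eq` the index n acts as a translation by log n together with the factor n^(-δ).
-/
theorem integral_meijerKernel (δ x : ℝ) {n : ℕ} (hn : n ≠ 0) :
    ∫ u, meijerKernel δ x n u =
      (Real.exp (-(δ * x)) * ∫ z, Real.exp (δ * z) * logMacdonald z) * (n : ℝ) ^ (-δ) := by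
  simp_rw [meijerKernel_eq, integral_const_mul]
  rw [integral_sub_left_eq_self (fun z => Real.exp (δ * z) * logMacdonald z),
    Real.rpow_def_of_pos (by positivity), mul_add, neg_add, Real.exp_add]
  ring_nf

/-- For δ < 1 one has (n/(n+1))^δ ≥ n/(n+1), so the difference is at most n^(-δ-1). The resulting
bound is summable exactly when δ > 1/2. -/
theorem sqrt_mul_rpow_sub_le {δ : ℝ} (hδ0 : 0 < δ) (hδ1 : δ < 1) {n : ℕ} (hn : n ≠ 0) :
    √(n : ℝ) * ((n : ℝ) ^ (-δ) - ((n + 1 : ℕ) : ℝ) ^ (-δ)) ≤ 1 / (n : ℝ) ^ (δ + 1 / 2) := by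
  have hn0 : (0 : ℝ) < n := by positivity
  have h1 : ((n : ℝ) / (n + 1)) ≤ ((n : ℝ) / (n + 1)) ^ δ := by
    conv_lhs => rw [← Real.rpow_one ((n : ℝ) / (n + 1))]
    exact Real.rpow_le_rpow_of_exponent_ge (by positivity)
      ((div_le_one (by positivity)).2 (by linarith)) hδ1.le
  have h2 : ((n + 1 : ℕ) : ℝ) ^ (-δ) = (n : ℝ) ^ (-δ) * ((n : ℝ) / (n + 1)) ^ δ := by
    rw [Real.div_rpow hn0.le (by positivity), Real.rpow_neg hn0.le, Real.rpow_neg (by positivity)]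
    have : (0 : ℝ) < (n : ℝ) ^ δ := by positivity
    push_cast
    field_simp
  have h3 : 1 - (n : ℝ) / (n + 1) ≤ 1 / n := by
    rw [one_sub_div (by positivity), div_le_div_iff₀ (by positivity) hn0]
    ring_nf
    linarith
  have h4 : (n : ℝ) ^ (-δ) - ((n + 1 : ℕ) : ℝ) ^ (-δ) ≤ (n : ℝ) ^ (-δ) * (1 / n) := by
    rw [h2, ← mul_one_sub]
    gcongr
    linarith
  calc _ ≤ √(n : ℝ) * ((n : ℝ) ^ (-δ) * (1 / n)) := by gcongr
    _ = _ := by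
      rw [Real.sqrt_eq_rpow, one_div (n : ℝ), ← Real.rpow_neg_one (n : ℝ), ← Real.rpow_add hn0,
        ← Real.rpow_add hn0, one_div ((n : ℝ) ^ (δ + 1 / 2)), ← Real.rpow_neg hn0.le]
      congr 1
      ring

theorem integrable_real_mul {κ : ℝ → ℝ} {f : ℝ → ℂ} (hκ : Integrable κ)
    (hf : IsBoundedMeasurable f) : Integrable fun u => (κ u : ℂ) * f u := by
  obtain ⟨hf, C, hC⟩ := hf
  exact hκ.ofReal.mul_bdd hf.aestronglyMeasurable (Eventually.of_forall hC)

theorem integrable_meijerIntegrand {δ : ℝ} (hδ : 0 < δ) {f : ℝ → ℂ} (hf : IsBoundedMeasurable f)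
    (x : ℝ) {n : ℕ} (hn : n ≠ 0) : Integrable (meijerIntegrand δ n f x) := by
  rw [funext (meijerIntegrand_eq δ hn f x)]
  exact integrable_real_mul (integrable_meijerKernel hδ x n) hf

theorem exp_mul_divisorKernel (δ x u : ℝ) :
    Real.exp (-(δ * u)) * divisorKernel (Real.exp (x - u)) = Real.exp (-(δ * x)) * (1 / 2 *
      ∫ w, fermiKernel δ w * fermiKernel δ (x - u - w)) := by
  rw [divisorKernel_exp]
  simp_rw [fermiKernel_zero_mul δ (x - u), integral_const_mul]
  rw [mul_left_comm, ← mul_assoc (Real.exp _), ← Real.exp_add]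
  ring_nf

theorem integrable_fermiKernel_convolution {δ : ℝ} (hδ : 0 < δ) :
    Integrable fun z => ∫ w, fermiKernel δ w * fermiKernel δ (z - w) :=
  (integrable_fermiKernel hδ).integrable_convolution (ContinuousLinearMap.mul ℝ ℝ)
    (integrable_fermiKernel hδ)

theorem integrable_divisorKernel_mul {δ : ℝ} (hδ : 0 < δ) {f : ℝ → ℂ}
    (hf : IsBoundedMeasurable f) (x : ℝ) : Integrable fun u : ℝ =>
      ((Real.exp (-(δ * u)) * divisorKernel (Real.exp (x - u)) : ℝ) : ℂ) * f u := by
  refine integrable_real_mul (κ := fun u =>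
    Real.exp (-(δ * u)) * divisorKernel (Real.exp (x - u))) ?_ hf
  simp_rw [exp_mul_divisorKernel]
  exact (((integrable_fermiKernel_convolution hδ).comp_sub_left x).const_mul _).const_mul _

theorem meijerPartialSum_eq (δ : ℝ) (f : ℝ → ℂ) (x : ℝ) (N : ℕ) : meijerPartialSum δ f x N =
    ∑ n ∈ Finset.Ioc 0 N, (altDivisor n : ℂ) * ∫ u, (meijerKernel δ x n u : ℂ) * f u := by
  rw [meijerPartialSum, ← sum_altDivisor_mul fun n => meijerTransform δ n f x]
  refine Finset.sum_congr rfl fun n hn => ?_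
  rw [meijerTransform, funext (meijerIntegrand_eq δ (Finset.mem_Ioc.1 hn).1.ne' f x)]

theorem tendsto_altDivisorSum_mul_integral {δ : ℝ} (hδ : 1 / 2 < δ) {f : ℝ → ℂ}
    (hf : IsBoundedMeasurable f) (x : ℝ) : Tendsto (fun N : ℕ => altDivisorSum N *
      ∫ u, (meijerKernel δ x (N + 1) u : ℂ) * f u) atTop (𝓝 0) := by
  obtain ⟨C, hC⟩ := hf.2
  have hC0 : 0 ≤ C := (norm_nonneg _).trans (hC 0)
  have hδ0 : 0 < δ := by linarith
  set J := Real.exp (-(δ * x)) * ∫ z, Real.exp (δ * z) * logMacdonald z with hJ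
  have hJ0 : 0 ≤ J := mul_nonneg (Real.exp_pos _).le
    (integral_nonneg fun z => mul_nonneg (Real.exp_pos _).le (logMacdonald_nonneg _))
  have hlim : Tendsto (fun N : ℕ => 2 * J * C * ((N + 1 : ℕ) : ℝ) ^ (-(δ - 1 / 2))) atTop (𝓝 0) := by
    have h1 := (tendsto_rpow_neg_atTop (by linarith : 0 < δ - 1 / 2)).comp
      (tendsto_natCast_atTop_atTop.comp (tendsto_add_atTop_nat 1))
    simpa using h1.const_mul (2 * J * C)
  refine squeeze_zero_norm (fun N => ?_) hlim
  have hN : (0 : ℝ) < ((N + 1 : ℕ) : ℝ) := by positivity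
  have h1 : ‖∫ u, (meijerKernel δ x (N + 1) u : ℂ) * f u‖ ≤ J * ((N + 1 : ℕ) : ℝ) ^ (-δ) * C := by
    rw [← integral_meijerKernel δ x (Nat.succ_ne_zero N), ← integral_mul_const]
    refine norm_integral_le_of_norm_le ((integrable_meijerKernel hδ0 x _).mul_const C)
      (Eventually.of_forall fun u => ?_)
    rw [norm_mul, Complex.norm_real, Real.norm_of_nonneg (meijerKernel_nonneg _ _ _ _)]
    exact mul_le_mul_of_nonneg_left (hC u) (meijerKernel_nonneg _ _ _ _)
  have h2 : ‖altDivisorSum N‖ ≤ 2 * ((N + 1 : ℕ) : ℝ) ^ (1 / 2 : ℝ) := by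
    refine (norm_altDivisorSum_le N).trans ?_
    rw [← Real.sqrt_eq_rpow]
    gcongr
    omega
  rw [norm_mul]
  calc _ ≤ (2 * ((N + 1 : ℕ) : ℝ) ^ (1 / 2 : ℝ)) * (J * ((N + 1 : ℕ) : ℝ) ^ (-δ) * C) := by gcongr
    _ = _ := by
      rw [show -(δ - 1 / 2) = 1 / 2 + -δ by ring, Real.rpow_add hN]
      ring

/-- Bounding the transforms one by one would lose the cancellation of signs; summation by parts
retains it and leaves an absolutely convergent series of integrals. -/
theorem tendsto_meijerPartialSum {δ : ℝ} (hδ : 1 / 2 < δ) (hδ1 : δ < 1) {f : ℝ → ℂ}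
    (hf : IsBoundedMeasurable f) (x : ℝ) : Tendsto (meijerPartialSum δ f x) atTop
      (𝓝 (∫ u : ℝ, ((Real.exp (-(δ * u)) * divisorKernel (Real.exp (x - u)) : ℝ) : ℂ) * f u)) := by
  obtain ⟨C, hC⟩ := hf.2
  have hC0 : 0 ≤ C := (norm_nonneg _).trans (hC 0)
  have hδ0 : 0 < δ := by linarith
  set J := Real.exp (-(δ * x)) * ∫ z, Real.exp (δ * z) * logMacdonald z with hJ
  have hJ0 : 0 ≤ J := mul_nonneg (Real.exp_pos _).le
    (integral_nonneg fun z => mul_nonneg (Real.exp_pos _).le (logMacdonald_nonneg _))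
  let T : ℕ → ℂ := fun n => ∫ u, (meijerKernel δ x n u : ℂ) * f u
  have hTi : ∀ n, Integrable fun u => (meijerKernel δ x n u : ℂ) * f u := fun n =>
    integrable_real_mul (integrable_meijerKernel hδ0 x n) hf
  let F : ℕ → ℝ → ℂ := fun n u => altDivisorSum n *
    ((meijerKernel δ x n u : ℂ) * f u - (meijerKernel δ x (n + 1) u : ℂ) * f u)
  have hFi : ∀ n, Integrable (F n) := fun n => ((hTi n).sub (hTi (n + 1))).const_mul _
  have hFint : ∀ n, ∫ u, F n u = altDivisorSum n * (T n - T (n + 1)) := fun n => by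
    simp only [F, T]
    rw [integral_const_mul, integral_sub (hTi n) (hTi (n + 1))]
  have hFs : Summable fun n => ∫ u, ‖F n u‖ := by
    refine Summable.of_nonneg_of_le (fun n => integral_nonneg fun u => norm_nonneg _) (fun n => ?_)
      ((Real.summable_one_div_nat_rpow.2 (by linarith : 1 < δ + 1 / 2)).mul_left (2 * J * C))
    rcases eq_or_ne n 0 with rfl | hn
    · simp [F, altDivisorSum]
      positivity
    -- Monotonicity in n makes the L¹ norm of a difference of kernels equal to the difference of
    -- their integrals.
    have hd : ∀ u, meijerKernel δ x (n + 1) u ≤ meijerKernel δ x n u := fun u =>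
      mul_le_mul_of_nonneg_left (logMacdonald_add_log_succ_le _ n) (Real.exp_pos _).le
    have hnorm : ∀ u, ‖F n u‖ ≤ 2 * √(n : ℝ) *
        ((meijerKernel δ x n u - meijerKernel δ x (n + 1) u) * C) := fun u => by
      simp only [F]
      rw [← sub_mul, ← Complex.ofReal_sub, norm_mul, norm_mul, Complex.norm_real,
        Real.norm_of_nonneg (sub_nonneg.2 (hd u))]
      have := sub_nonneg.2 (hd u)
      gcongr
      · exact norm_altDivisorSum_le n
      · exact hC u
    have hi1 := integrable_meijerKernel hδ0 x n
    have hi2 := integrable_meijerKernel hδ0 x (n + 1)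
    calc ∫ u, ‖F n u‖ ≤ ∫ u, 2 * √(n : ℝ) *
          ((meijerKernel δ x n u - meijerKernel δ x (n + 1) u) * C) :=
          integral_mono (hFi n).norm (((hi1.sub hi2).mul_const C).const_mul _) hnorm
      _ = 2 * J * C * (√(n : ℝ) * ((n : ℝ) ^ (-δ) - ((n + 1 : ℕ) : ℝ) ^ (-δ))) := by
          rw [integral_const_mul, integral_mul_const, integral_sub hi1 hi2,
            integral_meijerKernel δ x hn, integral_meijerKernel δ x (Nat.succ_ne_zero n)]
          ring
      _ ≤ _ := by
          gcongr
          exact sqrt_mul_rpow_sub_le hδ0 hδ1 hn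
  have hsum := hasSum_integral_of_summable_integral_norm hFi hFs
  have ht : ∀ u, ∑' n, F n u =
      ((Real.exp (-(δ * u)) * divisorKernel (Real.exp (x - u)) : ℝ) : ℂ) * f u := by
    intro u
    refine HasSum.tsum_eq ?_
    have h1 := (hasSum_altDivisorSum_mul (x - u)).mul_left ((Real.exp (-(δ * u)) : ℂ) * f u)
    rw [show ((Real.exp (-(δ * u)) * divisorKernel (Real.exp (x - u)) : ℝ) : ℂ) * f u =
      (Real.exp (-(δ * u)) : ℂ) * f u * (divisorKernel (Real.exp (x - u)) : ℂ) by push_cast; ring]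
    refine h1.of_eq fun n => ?_
    simp only [F, meijerKernel]
    push_cast
    ring
  simp_rw [ht, hFint] at hsum
  have h1 := hsum.tendsto_sum_nat.comp (tendsto_add_atTop_nat 1)
  have h2 := (tendsto_altDivisorSum_mul_integral hδ hf x).add h1
  rw [zero_add] at h2
  refine h2.congr fun N => ?_
  rw [meijerPartialSum_eq]
  exact (sum_Ioc_mul_by_parts (fun n => (altDivisor n : ℂ)) T N).symm

/-! ### Uniqueness, and solutions from zeros of ζ -/

theorem integrable_fermiKernel_ofReal {δ : ℝ} (hδ : 0 < δ) :
    Integrable fun w => (fermiKernel δ w : ℂ) := (integrable_fermiKernel hδ).ofReal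

/-- The limit of the series is, up to a factor, the twofold convolution with the Fermi kernel. -/
theorem integral_divisorKernel_mul {δ : ℝ} (hδ : 0 < δ) {f : ℝ → ℂ} (hf : IsBoundedMeasurable f)
    (x : ℝ) :
    ∫ u : ℝ, ((Real.exp (-(δ * u)) * divisorKernel (Real.exp (x - u)) : ℝ) : ℂ) * f u =
      (Real.exp (-(δ * x)) * (1 / 2) : ℝ) * ∫ v, (fermiKernel δ (x - v) : ℂ) *
        ∫ u, (fermiKernel δ (v - u) : ℂ) * f u := by
  obtain ⟨hfm, C, hC⟩ := hf
  rw [← integral_convolution_mul_swap (integrable_fermiKernel_ofReal hδ)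
    ((integrable_fermiKernel_ofReal hδ).comp_sub_left x) hfm.aestronglyMeasurable hC,
    ← integral_const_mul]
  congr 1; ext u
  have h1 : ∫ w, fermiKernel δ w * fermiKernel δ (x - u - w) =
      ∫ v, fermiKernel δ (x - v) * fermiKernel δ (v - u) := by
    rw [← integral_sub_left_eq_self (fun w => fermiKernel δ w * fermiKernel δ (x - u - w)) _ x]
    congr 1; ext v
    congr 2
    ring
  have h2 : ∫ v, (fermiKernel δ (x - v) : ℂ) * fermiKernel δ (v - u) =
      ((∫ v, fermiKernel δ (x - v) * fermiKernel δ (v - u) : ℝ) : ℂ) := by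
    rw [← integral_complex_ofReal]
    simp
  rw [exp_mul_divisorKernel, h1, h2]
  push_cast
  ring

/-- Allows the Wiener theorem to be applied to φ * f as well as to f. -/
theorem isBoundedMeasurable_convolution {δ : ℝ} (hδ : 0 < δ) {f : ℝ → ℂ}
    (hf : IsBoundedMeasurable f) :
    IsBoundedMeasurable fun v => ∫ u, (fermiKernel δ (v - u) : ℂ) * f u := by
  obtain ⟨hfm, C, hC⟩ := hf
  refine ⟨AEStronglyMeasurable.aemeasurable ?_, ∫ w, fermiKernel δ w * C, fun v => ?_⟩
  · refine AEStronglyMeasurable.integral_prod_right'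
      (f := fun p : ℝ × ℝ => (fermiKernel δ (p.1 - p.2) : ℂ) * f p.2) ?_
    refine AEStronglyMeasurable.mul ?_ hfm.aestronglyMeasurable.comp_snd
    exact (Complex.continuous_ofReal.comp ((continuous_fermiKernel δ).comp
      (continuous_fst.sub continuous_snd))).aestronglyMeasurable
  · rw [← integral_sub_left_eq_self (fun w => fermiKernel δ w * C) _ v]
    refine norm_integral_le_of_norm_le
      (((integrable_fermiKernel hδ).mul_const C).comp_sub_left v) (Eventually.of_forall fun u => ?_)
    rw [norm_mul, Complex.norm_real, Real.norm_of_nonneg (fermiKernel_nonneg _ _)]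
    exact mul_le_mul_of_nonneg_left (hC u) (fermiKernel_nonneg _ _)

theorem ae_eq_zero_of_fermiKernel_convolution_eq_zero {δ : ℝ} (hδ : 0 < δ) (hδ1 : δ < 1)
    (hζ : ∀ s : ℂ, s.re = δ → riemannZeta s ≠ 0) {f : ℝ → ℂ} (hf : IsBoundedMeasurable f)
    (h : ∀ᵐ x, ∫ u, (fermiKernel δ (x - u) : ℂ) * f u = 0) : f =ᵐ[volume] 0 := by
  obtain ⟨hfm, C, hC⟩ := hf
  exact ae_eq_zero_of_convolution_eq_zero (φ := fun w => (fermiKernel δ w : ℂ))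
    (integrable_pow_mul_fermiKernel hδ) (integrable_fermiKernel_ofReal hδ).aestronglyMeasurable
    (fourier_fermiKernel_ne_zero hδ hδ1 hζ) hfm.aestronglyMeasurable hC h

theorem ae_eq_zero_of_meijer_equation {δ : ℝ} (hδ : 1 / 2 < δ) (hδ1 : δ < 1)
    (hζ : ∀ s : ℂ, s.re = δ → riemannZeta s ≠ 0) {f : ℝ → ℂ} (hf : IsBoundedMeasurable f)
    (h : ∀ x : ℝ, Tendsto (meijerPartialSum δ f x) atTop (𝓝 0)) : f =ᵐ[volume] 0 := by
  have hδ0 : 0 < δ := by linarith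
  refine ae_eq_zero_of_fermiKernel_convolution_eq_zero hδ0 hδ1 hζ hf ?_
  refine ae_eq_zero_of_fermiKernel_convolution_eq_zero hδ0 hδ1 hζ
    (isBoundedMeasurable_convolution hδ0 hf) (Eventually.of_forall fun x => ?_)
  have h1 := tendsto_nhds_unique (tendsto_meijerPartialSum hδ hδ1 hf x) (h x)
  rw [integral_divisorKernel_mul hδ0 hf] at h1
  refine (mul_eq_zero.1 h1).resolve_left ?_
  exact_mod_cast (mul_pos (Real.exp_pos _) one_half_pos).ne'

theorem isBoundedMeasurable_fourierChar (ξ : ℝ) :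
    IsBoundedMeasurable fun u => (Real.fourierChar (ξ * u) : ℂ) := by
  refine ⟨Continuous.aemeasurable ?_, 1, fun u => (Circle.norm_coe _).le⟩
  exact continuous_subtype_val.comp (Real.continuous_fourierChar.comp (continuous_const_mul ξ))

/-- Characters are eigenfunctions of convolution, with the Fourier transform as eigenvalue. -/
theorem fermiKernel_convolution_fourierChar (δ ξ v : ℝ) :
    ∫ u, (fermiKernel δ (v - u) : ℂ) * (Real.fourierChar (ξ * u) : ℂ) =
      (Real.fourierChar (ξ * v) : ℂ) * 𝓕 (fun w => (fermiKernel δ w : ℂ)) ξ := by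
  rw [Real.fourier_eq, ← integral_const_mul, ← integral_sub_left_eq_self _ _ v]
  congr 1; ext u
  rw [Circle.smul_def, smul_eq_mul, ← mul_assoc, ← Circle.coe_mul, ← AddChar.map_add_eq_mul,
    sub_sub_cancel, mul_comm]
  congr 3
  simp only [RCLike.inner_apply, conj_trivial]
  ring

/-- A zero of `ζ` gives a character that solves the equation. -/
theorem tendsto_meijerPartialSum_fourierChar {s : ℂ} (hs : 1 / 2 < s.re) (hs1 : s.re < 1)
    (hζ : riemannZeta s = 0) (x : ℝ) :
    Tendsto (meijerPartialSum s.re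
      (fun u => (Real.fourierChar (-(s.im / (2 * Real.pi)) * u) : ℂ)) x) atTop (𝓝 0) := by
  have hδ0 : 0 < s.re := by linarith
  have hf := isBoundedMeasurable_fourierChar (-(s.im / (2 * Real.pi)))
  have h0 : 𝓕 (fun w => (fermiKernel s.re w : ℂ)) (-(s.im / (2 * Real.pi))) = 0 := by
    rw [fourier_fermiKernel hδ0 hs1.ne]
    -- The frequency is chosen so that -2πξ = Im s, which places the argument of ζ at s.
    have : (⟨s.re, -(2 * Real.pi * -(s.im / (2 * Real.pi)))⟩ : ℂ) = s :=
      Complex.ext rfl (by field_simp)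
    rw [this, hζ, mul_zero, mul_zero]
  have h1 := tendsto_meijerPartialSum hs hs1 hf x
  rw [integral_divisorKernel_mul hδ0 hf] at h1
  simpa only [fermiKernel_convolution_fourierChar, h0, mul_zero, integral_zero] using h1

theorem theorem8 :
    -- Every term is defined, and for all bounded measurable `f` the series converges, to the
    -- convolution of `f` with the (absolutely convergent) sum of the kernels.
    ((∀ t : ℝ, 0 < t → Summable (divisorKernelTerm t)) ∧
      ∀ δ : ℝ, 1 / 2 < δ → δ < 1 → ∀ f : ℝ → ℂ, IsBoundedMeasurable f → ∀ x : ℝ,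
        (∀ n : ℕ, 1 ≤ n → Integrable (meijerIntegrand δ n f x) volume) ∧
        Integrable (fun u : ℝ =>
          ((Real.exp (-(δ * u)) * divisorKernel (Real.exp (x - u)) : ℝ) : ℂ) * f u) volume ∧
        Tendsto (meijerPartialSum δ f x) atTop
          (𝓝 (∫ u : ℝ,
            ((Real.exp (-(δ * u)) * divisorKernel (Real.exp (x - u)) : ℝ) : ℂ) * f u))) ∧
    -- The Riemann hypothesis is equivalent to the absence of nontrivial solutions.
    (RiemannHypothesis ↔
      ∀ δ : ℝ, 1 / 2 < δ → δ < 1 → ∀ f : ℝ → ℂ, IsBoundedMeasurable f →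
        (∀ x : ℝ, Tendsto (meijerPartialSum δ f x) atTop (𝓝 0)) → f =ᵐ[volume] 0) := by

  refine ⟨⟨fun t ht => summable_divisorKernelTerm ht, fun δ hδ hδ1 f hf x => ?_⟩, ?_, ?_⟩
  · exact ⟨fun n hn => integrable_meijerIntegrand (by linarith) hf x (by omega),
      integrable_divisorKernel_mul (by linarith) hf x, tendsto_meijerPartialSum hδ hδ1 hf x⟩
  · intro hRH δ hδ hδ1 f hf h
    refine ae_eq_zero_of_meijer_equation hδ hδ1 (fun s hs h0 => ?_) hf h
    have hre := hRH s h0 ?_ ?_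
    · linarith
    · rintro ⟨n, rfl⟩
      have : (-2 * ((n : ℂ) + 1)).re = -2 * ((n : ℝ) + 1) := by simp
      have hn : (0 : ℝ) ≤ n := n.cast_nonneg
      linarith
    · rintro rfl
      rw [Complex.one_re] at hs
      linarith
  · intro h
    by_contra hRH
    obtain ⟨s, hs, hs1, hζ⟩ := exists_zero_of_not_riemannHypothesis hRH
    have h0 := h s.re hs hs1 _ (isBoundedMeasurable_fourierChar _)
      (tendsto_meijerPartialSum_fourierChar hs hs1 hζ)
    -- A character has modulus 1 everywhere, so it cannot vanish even at one point.
    obtain ⟨u, hu⟩ := h0.exists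
    exact Circle.coe_ne_zero _ hu
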